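/- Write $P_a$ for the path on $a$ vertices, $+$ for disjoint union and $sG$ for the disjoint union of $s$ copies of $G$; a graph is $H$-free if it has no induced subgraph isomorphic to $H$. In the adjacency-list (AL) model, a graph on the vertex set $\{0,\dots,n-1\}$ is given as a stream in which the vertices arrive one by one, in an arbitrary order, each together with the list of all its neighbours (in an arbitrary order), so that every edge appears once for each of its endpoints. A $p$-pass streaming algorithm with $s$ bits of memory reads the same stream $p$ times and keeps only $s$ bits from one arrival to the next; its computation is otherwise unrestricted (it may depend on $n$ and on the number of the current pass), and it may be randomized. It solves Diameter on a class of graphs if for every graph $G$ on $\{0,\dots,n-1\}$ in the class and every AL stream of $G$ it outputs $\max_{u,v} d_G(u,v)$, with probability at least $2/3$ (deterministic algorithms are a special case). **Theorem.** Let $H$ be a fixed finite graph that is not isomorphic to an induced subgraph of $P_4$ and is not isomorphic to $3P_1$, $P_3+P_1$ or $P_2+2P_1$. Then every $p$-pass streaming algorithm in the AL model that solves Diameter on the $H$-free graphs, even only on the connected $H$-free graphs, needs $\Omega(n/p)$ bits of memory. That is, there are $c>0$ and $N$, depending only on $H$, such that for all $n\ge N$, $p\ge 1$ and $s$: if some $p$-pass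 AL streaming algorithm with $s$ bits of memory solves Diameter on the connected $H$-free graphs on $n$ vertices, then $s\ge c\,n/p$. -/

import Mathlib

/-- One item of an adjacency-list (AL) stream over the vertex set `{0, …, n - 1}`:
a vertex that arrives, together with a list of its neighbours. -/
abbrev ALItem (n : ℕ) : Type := Fin n × List (Fin n)

/-- `stream` is an adjacency-list stream of the graph `G`: every vertex arrives exactly once, in an
arbitrary order, and each vertex comes with all its neighbours, each listed once, in an arbitrary
order. (So every edge is present in the stream once for each of its two endpoints.) -/
def IsALStream {n : ℕ} (G : SimpleGraph (Fin n)) (stream : List (ALItem n)) : Prop :=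
  (stream.map Prod.fst).Nodup ∧
  (∀ v : Fin n, v ∈ stream.map Prod.fst) ∧
  ∀ item ∈ stream, item.2.Nodup ∧ ∀ w : Fin n, w ∈ item.2 ↔ G.Adj item.1 w

/-- The contents of a memory of `s` bits. -/
abbrev BitMemory (s : ℕ) : Type := Fin s → Bool

/-- A deterministic streaming algorithm for AL streams on `n` vertices with `s` bits of memory, with
outputs in `ℕ ∪ {∞}`. The computation is unrestricted: it is given by arbitrary functions, which may
depend on `n`, and on the number of the current pass. The memory is the only information that is
kept from one arrival of a vertex to the next. In particular this comprises the algorithms which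
read the adjacency lists edge by edge within the same memory. -/
structure ALAlgorithm (n s : ℕ) where
  /-- The initial memory. -/
  init : BitMemory s
  /-- The new memory, given the number of the pass, the old memory and the item that is read. -/
  step : ℕ → BitMemory s → ALItem n → BitMemory s
  /-- The new memory at the end of a pass, given the number of the pass and the old memory. -/
  endPass : ℕ → BitMemory s → BitMemory s
  /-- The output, given the final memory. -/
  output : BitMemory s → ℕ∞

namespace ALAlgorithm

/-- The memory of the algorithm after `p` passes over the stream. -/
def memoryAfter {n s : ℕ} (A : ALAlgorithm n s) (stream : List (ALItem n)) : ℕ → BitMemory s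
  | 0 => A.init
  | p + 1 => A.endPass p (stream.foldl (A.step p) (A.memoryAfter stream p))

/-- The output of the algorithm after `p` passes over the stream. -/
def run {n s : ℕ} (A : ALAlgorithm n s) (p : ℕ) (stream : List (ALItem n)) : ℕ∞ :=
  A.output (A.memoryAfter stream p)

end ALAlgorithm

/-- The randomized streaming algorithm `𝒜` (a probability distribution on deterministic ones) solves
Diameter with `p` passes on the connected `H`-free graphs with vertex set `{0, …, n - 1}`: for each
such graph `G` and each AL stream of `G`, the output after `p` passes over that stream is
`max_{s, t} d(s, t)` with probability at least `2 / 3`. The deterministic algorithms are the case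
of a point mass. -/
def SolvesDiameterOnConnectedFree {W : Type*} (H : SimpleGraph W) {n s : ℕ}
    (𝒜 : PMF (ALAlgorithm n s)) (p : ℕ) : Prop :=
  ∀ G : SimpleGraph (Fin n), G.Connected → ¬ H.IsIndContained G →
    ∀ stream : List (ALItem n), IsALStream G stream →
      2 / 3 ≤ 𝒜.toOuterMeasure {A | A.run p stream = G.ediam}

/-!
The proof reduces disjointness of two bit vectors `x`, `y` of length `m` to Diameter, with `m` linear
in `n`.

*Hard graphs.* A graph `H` other than the exceptions contains a cycle or an induced claw, `4P₁`, `2P₂`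
or `P₄ + P₁` (`contains_hard_pattern`). For each of these patterns there is a family of connected
graphs `G x y` that avoid it, whose vertices split into two parts such that the neighbourhoods in the
first part depend on `x` only and those in the second part on `y` only, while the diameter tells
whether some `i` has `x i = y i = 1`. These are trees (`exists_reduction_of_not_isAcyclic`), claw-free
graphs made of two pairs of cliques (`exists_reduction_of_hasClaw`), split graphs without `2P₂`, and
graphs covered by three cliques without `4P₁` and `P₄ + P₁` (`exists_reduction_of_free`).

*Streams and rectangles.* On a stream that lists the first part before the second one, the memories
after each part in each of the `p` passes form a transcript of `2 * s * p` bits, and the pairs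
`(x, y)` with a given transcript form a rectangle (`exists_isRectangular_memoryAfter`).

*Disjointness.* Take uniform vectors `d`, `r`, `s`, put `x = r ∧ d` and `y = s ∧ ¬d`, and plant in both
vectors a common bit `b` in a random coordinate `i`. The pair is disjoint if `b = 0` and intersects if
`b = 1`. Given `d`, the two vectors are independent, so a rectangle `f × g` has planted weight
`F b * G b`. If `F 1 < (1 - ε) * F 0` then coordinate `i` is biased on the rectangle; a rectangle of
density `q` has only `O(log (1 / q))` biased coordinates (`card_biased_le_log`), and the average of
`log (1 / q)` over the `N` rectangles of a partition is at most `log N` (`sum_mul_log_div_le`). The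
restriction to coordinates that are free in the first vector is harmless because the planted weights
do not depend on `d i` (`sum_plantSum_biased_le`). So the two values of `b` are accepted with almost
the same probability unless `log N` is linear in `m` (`card_le_log_of_isRectangular`). A randomized
algorithm with error `1 / 3` yields, by averaging, a deterministic one with advantage `1 / 3`.
-/

/-! ### Operations on bit vectors -/

section Disjointness

variable {ι : Type} [DecidableEq ι]

/-- The vector `r` restricted to the coordinates where `d` is `true`. -/
def maskBits (d r : ι → Bool) : ι → Bool := fun i => r i && d i

/-- The complementary mask. -/
def notBits (d : ι → Bool) : ι → Bool := fun i => !d i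

/-- The involution of the cube that flips coordinate `i`. -/
def flipBit (i : ι) : Equiv.Perm (ι → Bool) :=
  Function.Involutive.toPerm (fun r => Function.update r i (!r i)) (by
    intro r
    simp)

@[simp] theorem flipBit_apply (i : ι) (r : ι → Bool) :
    flipBit i r = Function.update r i (!r i) := rfl

theorem update_maskBits_update (d r : ι → Bool) (i : ι) (b c : Bool) :
    Function.update (maskBits (Function.update d i c) r) i b =
      Function.update (maskBits d r) i b := by
  ext j
  by_cases hj : j = i
  · subst hj; simp
  · simp [hj, maskBits]

theorem maskBits_update_of_true {d : ι → Bool} {i : ι} (hd : d i = true) (r : ι → Bool)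
    (b : Bool) : maskBits d (Function.update r i b) = Function.update (maskBits d r) i b := by
  ext j
  by_cases hj : j = i
  · subst hj; simp [maskBits, hd]
  · simp [hj, maskBits]

variable [Fintype ι]

/-! ### Biased coordinates of a dense set of bit vectors -/

/-- The sign of a bit: `1` for `false` and `-1` for `true`. -/
def bitSign (b : Bool) : ℝ := if b then -1 else 1

theorem sum_exp_bitSign_le (S : Finset ι) (δ : ℝ) :
    ∑ r : ι → Bool, Real.exp (∑ i ∈ S, δ * bitSign (r i)) ≤
      2 ^ Fintype.card ι * Real.exp (S.card * (δ ^ 2 / 2)) := by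
  let g : ι → Bool → ℝ := fun i b => if i ∈ S then Real.exp (δ * bitSign b) else 1
  have h1 : ∀ r : ι → Bool, Real.exp (∑ i ∈ S, δ * bitSign (r i)) = ∏ i, g i (r i) := by
    intro r
    rw [Real.exp_sum, ← Finset.prod_filter]
    simp
  have h2 : ∑ r : ι → Bool, ∏ i, g i (r i) = ∏ i, ∑ b, g i b := by
    rw [Finset.prod_univ_sum, Fintype.piFinset_univ]
  have h3 : ∀ i, ∑ b, g i b ≤ 2 * (if i ∈ S then Real.exp (δ ^ 2 / 2) else 1) := by
    intro i
    by_cases hi : i ∈ S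
    · have := Real.cosh_le_exp_half_sq δ
      rw [Real.cosh_eq] at this
      simp only [g, hi, if_true, bitSign, Fintype.sum_bool]
      simp only [mul_neg, mul_one, Bool.false_eq_true, if_false]
      linarith
    · simp [g, hi]
  simp_rw [h1]
  rw [h2]
  refine (Finset.prod_le_prod (fun i _ => ?_) (fun i _ => h3 i)).trans_eq ?_
  · refine Finset.sum_nonneg fun b _ => ?_
    simp only [g]
    split_ifs
    · exact (Real.exp_pos _).le
    · exact zero_le_one
  · rw [Finset.prod_mul_distrib, ← Finset.prod_filter]
    simp [← Real.exp_nat_mul]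

/-- A weight function of total weight `P` on the cube cannot be biased in many coordinates, unless
`P` is exponentially small: this is the Gibbs variational inequality applied to the sum of the
signs of the biased coordinates. -/
theorem card_biased_le_log (W : (ι → Bool) → ℝ) (h0 : ∀ r, 0 ≤ W r) (h1 : ∀ r, W r ≤ 1)
    (hpos : 0 < ∑ r, W r) (S : Finset ι) {δ : ℝ} (hδ : 0 ≤ δ)
    (hS : ∀ i ∈ S, δ * ∑ r, W r ≤ ∑ r, W r * bitSign (r i)) :
    δ ^ 2 / 2 * S.card ≤ Real.log (2 ^ Fintype.card ι / ∑ r, W r) := by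
  set P := ∑ r, W r with hP
  set z : (ι → Bool) → ℝ := fun r => ∑ i ∈ S, δ * bitSign (r i) with hz
  set E := ∑ r, Real.exp (z r) with hE
  have hEpos : 0 < E := Finset.sum_pos (fun r _ => Real.exp_pos _) Finset.univ_nonempty
  have hE' : E ≤ 2 ^ Fintype.card ι * Real.exp (S.card * (δ ^ 2 / 2)) := sum_exp_bitSign_le S δ
  set c := Real.log (E / P) with hc
  have hexp : Real.exp c = E / P := Real.exp_log (div_pos hEpos hpos)
  have hlow : δ ^ 2 * S.card * P ≤ ∑ r, W r * z r := by
    have : ∑ r, W r * z r = ∑ i ∈ S, δ * ∑ r, W r * bitSign (r i) := by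
      simp only [hz, Finset.mul_sum]
      rw [Finset.sum_comm]
      exact Finset.sum_congr rfl fun i _ => Finset.sum_congr rfl fun r _ => by ring
    rw [this]
    calc δ ^ 2 * S.card * P = ∑ i ∈ S, δ * (δ * P) := by
          rw [Finset.sum_const, nsmul_eq_mul]; ring
      _ ≤ _ := Finset.sum_le_sum fun i hi => mul_le_mul_of_nonneg_left (hS i hi) hδ
  have hup : ∑ r, W r * z r ≤ c * P := by
    -- `z ≤ exp (z - c) + c - 1` pointwise; the value of `c` makes the sum over `r` sharp.
    have hr : ∀ r, W r * z r ≤ Real.exp (z r) * Real.exp (-c) + W r * (c - 1) := by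
      intro r
      have e1 : z r - c + 1 ≤ Real.exp (z r - c) := Real.add_one_le_exp _
      have e2 : Real.exp (z r - c) = Real.exp (z r) * Real.exp (-c) := by
        rw [← Real.exp_add]; rfl
      have e3 : W r * (z r - c + 1) ≤ W r * Real.exp (z r - c) :=
        mul_le_mul_of_nonneg_left e1 (h0 r)
      have e4 : W r * Real.exp (z r - c) ≤ 1 * Real.exp (z r - c) :=
        mul_le_mul_of_nonneg_right (h1 r) (Real.exp_pos _).le
      linarith
    calc ∑ r, W r * z r ≤ ∑ r, (Real.exp (z r) * Real.exp (-c) + W r * (c - 1)) :=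
          Finset.sum_le_sum fun r _ => hr r
      _ = E * Real.exp (-c) + P * (c - 1) := by
          rw [Finset.sum_add_distrib, ← Finset.sum_mul, ← Finset.sum_mul]
      _ = c * P := by
          rw [Real.exp_neg, hexp]
          field_simp
          ring
  have hmain : δ ^ 2 * S.card ≤ c := by
    have := hlow.trans hup
    exact le_of_mul_le_mul_right this hpos
  have hc' : c ≤ Real.log (2 ^ Fintype.card ι / P) + S.card * (δ ^ 2 / 2) := by
    have : E / P ≤ 2 ^ Fintype.card ι / P * Real.exp (S.card * (δ ^ 2 / 2)) := by
      rw [div_mul_eq_mul_div]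
      exact div_le_div_of_nonneg_right hE' hpos.le
    have h2 := Real.log_le_log (div_pos hEpos hpos) this
    rwa [Real.log_mul (by positivity) (by positivity), Real.log_exp] at h2
  linarith

/-- The entropy of a finite measure with `N` atoms is at most `log N`, in an unnormalized form. -/
theorem sum_mul_log_div_le {T : Type*} [Fintype T] (q : T → ℝ) (hq : ∀ t, 0 ≤ q t) {M : ℝ}
    (hM : 0 < M) (hsum : ∑ t, q t = M) :
    ∑ t, q t * Real.log (M / q t) ≤ M * Real.log (Fintype.card T) := by
  have hT : Nonempty T := by
    by_contra h
    rw [not_nonempty_iff] at h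
    simp at hsum
    exact hM.ne hsum
  set N : ℝ := (Fintype.card T : ℝ) with hN
  have hNpos : 0 < N := by
    rw [hN]; exact_mod_cast Fintype.card_pos
  have key : ∀ t, q t * Real.log (M / q t) ≤ q t * Real.log N + M / N - q t := by
    intro t
    rcases (hq t).eq_or_lt with h | h
    · rw [← h]
      simp only [zero_mul, zero_add, sub_zero]
      positivity
    · have e1 : Real.log (M / q t / N) ≤ M / q t / N - 1 :=
        Real.log_le_sub_one_of_pos (by positivity)
      rw [Real.log_div (by positivity) hNpos.ne'] at e1
      have e2 := mul_le_mul_of_nonneg_left e1 h.le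
      have e3 : q t * (M / q t / N - 1) = M / N - q t := by field_simp
      linarith
  calc ∑ t, q t * Real.log (M / q t) ≤ ∑ t, (q t * Real.log N + M / N - q t) :=
        Finset.sum_le_sum fun t _ => key t
    _ = M * Real.log N := by
        rw [Finset.sum_sub_distrib, Finset.sum_add_distrib, ← Finset.sum_mul, hsum]
        rw [Finset.sum_const, Finset.card_univ, nsmul_eq_mul, ← hN]
        field_simp
        ring

/-! ### Planting a bit in a random coordinate -/

/-- The total value of `f` over the vectors `r` masked by `d`, with the bit `b` planted in
coordinate `i`. -/
def plantSum (f : (ι → Bool) → ℝ) (d : ι → Bool) (i : ι) (b : Bool) : ℝ :=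
  ∑ r, f (Function.update (maskBits d r) i b)

theorem two_mul_sum_eq_sum_update (h : (ι → Bool) → ℝ) (i : ι) :
    2 * ∑ r, h r = ∑ r, h (Function.update r i false) + ∑ r, h (Function.update r i true) := by
  have e : ∑ r, h (flipBit i r) = ∑ r, h r := Equiv.sum_comp (flipBit i) h
  rw [two_mul]
  nth_rewrite 2 [← e]
  rw [← Finset.sum_add_distrib, ← Finset.sum_add_distrib]
  refine Finset.sum_congr rfl fun r _ => ?_
  have hr : Function.update r i (r i) = r := Function.update_eq_self i r
  cases hb : r i <;> rw [hb] at hr <;> simp [hb, hr, add_comm]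

theorem two_mul_sum_bitSign_eq (h : (ι → Bool) → ℝ) (i : ι) :
    2 * ∑ r, h r * bitSign (r i) =
      ∑ r, h (Function.update r i false) - ∑ r, h (Function.update r i true) := by
  rw [two_mul_sum_eq_sum_update _ i]
  simp [bitSign, ← Finset.sum_neg_distrib, sub_eq_add_neg]

theorem plantSum_update (f : (ι → Bool) → ℝ) (d : ι → Bool) (i : ι) (b c : Bool) :
    plantSum f (Function.update d i c) i b = plantSum f d i b := by
  simp only [plantSum, update_maskBits_update]

theorem plantSum_false_add_true (f : (ι → Bool) → ℝ) {d : ι → Bool} {i : ι} (hd : d i = true) :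
    plantSum f d i false + plantSum f d i true = 2 * ∑ r, f (maskBits d r) := by
  rw [two_mul_sum_eq_sum_update _ i]
  simp only [plantSum, maskBits_update_of_true hd]

theorem plantSum_false_sub_true (f : (ι → Bool) → ℝ) {d : ι → Bool} {i : ι} (hd : d i = true) :
    plantSum f d i false - plantSum f d i true =
      2 * ∑ r, f (maskBits d r) * bitSign (r i) := by
  rw [two_mul_sum_bitSign_eq (fun r => f (maskBits d r)) i]
  simp only [plantSum, maskBits_update_of_true hd]

theorem plantSum_false_of_false (f : (ι → Bool) → ℝ) {d : ι → Bool} {i : ι} (hd : d i = false) :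
    plantSum f d i false = ∑ r, f (maskBits d r) := by
  refine Finset.sum_congr rfl fun r _ => ?_
  congr 1
  ext j
  by_cases hj : j = i
  · subst hj; simp [maskBits, hd]
  · simp [hj]

theorem plantSum_nonneg {f : (ι → Bool) → ℝ} (h0 : ∀ r, 0 ≤ f r) (d : ι → Bool) (i : ι)
    (b : Bool) : 0 ≤ plantSum f d i b :=
  Finset.sum_nonneg fun _ _ => h0 _

/-- `∑ d, h d` is twice the sum over the `d` with `d i = true`, if `h` ignores coordinate `i`. -/
theorem sum_eq_two_mul_sum_ite (h : (ι → Bool) → ℝ) (i : ι)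
    (hh : ∀ d c, h (Function.update d i c) = h d) :
    ∑ d, h d = 2 * ∑ d : ι → Bool, if d i = true then h d else 0 := by
  rw [two_mul_sum_eq_sum_update _ i]
  simp [hh]

open Classical in
/-- The total weight of the rectangles `f t × g t` on the planted pairs `(0, 0)`, counted only where
planting `1` in the first argument loses more than the fraction `ε` of the weight. Such a loss makes
coordinate `i` biased on the support of `f t`, and by `card_biased_le_log` a rectangle has few
biased coordinates relative to the logarithm of its weight; `sum_mul_log_div_le` sums this up. -/
theorem sum_plantSum_biased_le {T : Type*} [Fintype T] (f g : T → (ι → Bool) → ℝ)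
    (f0 : ∀ t r, 0 ≤ f t r) (f1 : ∀ t r, f t r ≤ 1) (g0 : ∀ t r, 0 ≤ g t r)
    (g1 : ∀ t r, g t r ≤ 1) (hpart : ∀ x y, ∑ t, f t x * g t y = 1) {ε : ℝ} (hε : 0 < ε) :
    ∑ t, ∑ i, ∑ d, (if plantSum (f t) d i true < (1 - ε) * plantSum (f t) d i false then
      plantSum (f t) d i false * plantSum (g t) (notBits d) i false else 0) ≤
      32 / ε ^ 2 * (8 ^ Fintype.card ι * Real.log (Fintype.card T)) := by
  set m := Fintype.card ι with hm
  set P : T → (ι → Bool) → ℝ := fun t d => ∑ r, f t (maskBits d r) with hP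
  set Q : T → (ι → Bool) → ℝ := fun t d => ∑ r, g t (maskBits (notBits d) r) with hQ
  have P0 : ∀ t d, 0 ≤ P t d := fun t d => Finset.sum_nonneg fun _ _ => f0 _ _
  have Q0 : ∀ t d, 0 ≤ Q t d := fun t d => Finset.sum_nonneg fun _ _ => g0 _ _
  have Q1 : ∀ t d, Q t d ≤ 2 ^ m := by
    intro t d
    refine (Finset.sum_le_sum fun r _ => g1 t _).trans_eq ?_
    simp [hm]
  have hPQ : ∀ d, ∑ t, P t d * Q t d = 4 ^ m := by
    intro d
    simp only [hP, hQ, Finset.sum_mul_sum]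
    rw [Finset.sum_comm]
    simp_rw [Finset.sum_comm (s := (Finset.univ : Finset T))]
    simp only [hpart, Finset.sum_const, Finset.card_univ, Fintype.card_pi, Fintype.card_bool,
      Finset.prod_const, nsmul_eq_mul, mul_one]
    push_cast
    rw [← hm, ← mul_pow]; norm_num
  let bad : T → (ι → Bool) → Finset ι := fun t d => Finset.univ.filter fun i =>
    d i = true ∧ plantSum (f t) d i true < (1 - ε) * plantSum (f t) d i false
  -- Restrict the sum to `d i = true`, where the planted weights compare with `P` and `Q`.
  have hstep : ∀ t i, ∑ d, (if plantSum (f t) d i true < (1 - ε) * plantSum (f t) d i false then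
      plantSum (f t) d i false * plantSum (g t) (notBits d) i false else 0) ≤
      ∑ d, (if i ∈ bad t d then 4 * (P t d * Q t d) else 0) := by
    intro t i
    rw [sum_eq_two_mul_sum_ite _ i, Finset.mul_sum]
    · refine Finset.sum_le_sum fun d _ => ?_
      by_cases hd : d i = true
      · by_cases hb : plantSum (f t) d i true < (1 - ε) * plantSum (f t) d i false
        · have hmem : i ∈ bad t d := by simp [bad, hd, hb]
          rw [if_pos hd, if_pos hb, if_pos hmem]
          rw [plantSum_false_of_false (g t) (d := notBits d) (by simp [notBits, hd])]
          have e1 := plantSum_false_add_true (f t) hd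
          have e2 := plantSum_nonneg (f0 t) d i true
          have e3 : plantSum (f t) d i false ≤ 2 * P t d := by simp only [hP]; linarith
          have e4 := mul_le_mul_of_nonneg_right e3 (Q0 t d)
          change 2 * (plantSum (f t) d i false * Q t d) ≤ _
          linarith
        · have hmem : i ∉ bad t d := by simp [bad, hb]
          simp [hd, hb, hmem]
      · have hmem : i ∉ bad t d := by simp [bad, hd]
        simp [hd, hmem]
    · -- The planted weights ignore `d i`, for both masks.
      intro d c
      have hnot : notBits (Function.update d i c) = Function.update (notBits d) i (!c) := by
        ext j
        by_cases hj : j = i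
        · subst hj; simp [notBits]
        · simp [hj, notBits]
      rw [hnot]
      simp only [plantSum_update]
  have hcard : ∀ t d, P t d * Q t d * (bad t d).card ≤
      8 / ε ^ 2 * (P t d * Q t d * Real.log (4 ^ m / (P t d * Q t d))) := by
    intro t d
    rcases (P0 t d).eq_or_lt with hp | hp
    · simp [← hp]
    rcases (Q0 t d).eq_or_lt with hq | hq
    · simp [← hq]
    have hb := card_biased_le_log (fun r => f t (maskBits d r)) (fun r => f0 _ _)
      (fun r => f1 _ _) hp (bad t d) (δ := ε / 2) (by positivity) (by
        intro i hi
        simp only [bad, Finset.mem_filter, Finset.mem_univ, true_and] at hi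
        obtain ⟨hd, hi⟩ := hi
        have e1 := plantSum_false_add_true (f t) hd
        have e2 := plantSum_false_sub_true (f t) hd
        have e3 := plantSum_nonneg (f0 t) d i false
        have e4 : 0 ≤ ε * plantSum (f t) d i false := by positivity
        have e5 : P t d ≤ plantSum (f t) d i false := by simp only [hP]; linarith
        have e6 := mul_le_mul_of_nonneg_left e5 hε.le
        simp only [hP] at e6
        linarith)
    have hlog : Real.log (2 ^ m / P t d) ≤ Real.log (4 ^ m / (P t d * Q t d)) := by
      apply Real.log_le_log (by positivity)
      rw [div_le_div_iff₀ hp (by positivity)]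
      have : (4 : ℝ) ^ m = 2 ^ m * 2 ^ m := by rw [← mul_pow]; norm_num
      rw [this]
      have h3 : 2 ^ m * (P t d * Q t d) ≤ 2 ^ m * (P t d * 2 ^ m) :=
        mul_le_mul_of_nonneg_left (mul_le_mul_of_nonneg_left (Q1 t d) hp.le) (by positivity)
      linarith
    have h5 : ((bad t d).card : ℝ) ≤ 8 / ε ^ 2 * Real.log (4 ^ m / (P t d * Q t d)) := by
      have h6 : (ε / 2) ^ 2 / 2 * ((bad t d).card : ℝ) ≤ Real.log (4 ^ m / (P t d * Q t d)) :=
        hb.trans hlog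
      have h7 := mul_le_mul_of_nonneg_left h6 (show 0 ≤ 8 / ε ^ 2 by positivity)
      refine le_trans (le_of_eq ?_) h7
      field_simp
      ring
    have h8 := mul_le_mul_of_nonneg_left h5 (mul_pos hp hq).le
    linarith
  calc _ ≤ ∑ t, ∑ i, ∑ d, (if i ∈ bad t d then 4 * (P t d * Q t d) else 0) :=
        Finset.sum_le_sum fun t _ => Finset.sum_le_sum fun i _ => hstep t i
    _ = ∑ d, ∑ t, 4 * (P t d * Q t d * (bad t d).card) := by
        rw [Finset.sum_comm' (t' := Finset.univ) (s' := fun _ => Finset.univ) (by simp)]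
        rw [Finset.sum_comm]
        rw [Finset.sum_comm]
        rw [Finset.sum_congr rfl fun i _ => Finset.sum_comm]
        rw [Finset.sum_comm]
        refine Finset.sum_congr rfl fun d _ => ?_
        rw [Finset.sum_comm]
        refine Finset.sum_congr rfl fun t _ => ?_
        rw [← Finset.sum_filter, Finset.sum_const, nsmul_eq_mul, Finset.filter_mem_eq_inter,
          Finset.univ_inter]
        ring
    _ ≤ ∑ d : ι → Bool, 4 * (8 / ε ^ 2 * (4 ^ m * Real.log (Fintype.card T))) := by
        refine Finset.sum_le_sum fun d _ => ?_
        rw [← Finset.mul_sum]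
        refine mul_le_mul_of_nonneg_left ?_ (by norm_num)
        refine (Finset.sum_le_sum fun t _ => hcard t d).trans ?_
        rw [← Finset.mul_sum]
        refine mul_le_mul_of_nonneg_left ?_ (by positivity)
        exact sum_mul_log_div_le _ (fun t => mul_nonneg (P0 t d) (Q0 t d)) (by positivity) (hPQ d)
    _ = 32 / ε ^ 2 * (8 ^ m * Real.log (Fintype.card T)) := by
        rw [Finset.sum_const, Finset.card_univ, Fintype.card_pi]
        simp only [Fintype.card_bool, Finset.prod_const, Finset.card_univ, nsmul_eq_mul]
        rw [← hm]
        have : (8 : ℝ) ^ m = 2 ^ m * 4 ^ m := by rw [← mul_pow]; norm_num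
        rw [this]
        push_cast
        ring

end Disjointness

/-! ### The communication complexity of disjointness -/

section Communication

/-- A map of two arguments is rectangular if its fibres are combinatorial rectangles, as are the
fibres of the transcript of a two-party protocol. -/
def IsRectangular {X Y T : Type*} (τ : X → Y → T) : Prop :=
  ∀ x y x' y', τ x y = τ x' y' → τ x y' = τ x y

theorem IsRectangular.extend_left {X Y T M : Type*} {τ : X → Y → T} (h : IsRectangular τ)
    (α : T → X → M) : IsRectangular fun x y => (τ x y, α (τ x y) x) := by
  intro x y x' y' hxy
  have h1 := h x y x' y' (Prod.ext_iff.1 hxy).1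
  simp only [h1]

theorem IsRectangular.extend_right {X Y T M : Type*} {τ : X → Y → T} (h : IsRectangular τ)
    (β : T → Y → M) : IsRectangular fun x y => (τ x y, β (τ x y) y) := by
  intro x y x' y' hxy
  obtain ⟨e1, e2⟩ := Prod.ext_iff.1 hxy
  have h1 := h x y x' y' e1
  simp only at e1 e2
  simp only [h1, e2]
  rw [e1]

theorem IsRectangular.eq_iff {X Y T : Type*} {τ : X → Y → T} (h : IsRectangular τ) (t : T) (x : X)
    (y : Y) : τ x y = t ↔ (∃ y', τ x y' = t) ∧ ∃ x', τ x' y = t := by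
  constructor
  · exact fun hxy => ⟨⟨y, hxy⟩, ⟨x, hxy⟩⟩
  · rintro ⟨⟨y', h1⟩, ⟨x', h2⟩⟩
    rw [← h1]
    exact h x y' x' y (h1.trans h2.symm)

variable {ι : Type} [Fintype ι] [DecidableEq ι]

/-- The two bit vectors of the hard distribution: `r` and `s` are uniform, and the mask `d` decides
for each coordinate which of the two vectors may be `1` there. The bit `b` is planted in both
vectors in coordinate `i`. -/
def plantPair (d r s : ι → Bool) (i : ι) (b : Bool) : (ι → Bool) × (ι → Bool) :=
  (Function.update (maskBits d r) i b, Function.update (maskBits (notBits d) s) i b)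

open Classical in
/-- A rectangular map with values in `T` can tell planted `(1, 1)` from planted `(0, 0)` with
constant advantage only if `log |T|` is linear in the number of coordinates. -/
theorem card_le_log_of_isRectangular {T : Type} [Fintype T]
    {τ : (ι → Bool) → (ι → Bool) → T} (hτ : IsRectangular τ) (Z : T → Prop)
    (hadv : 1 / 3 * ((Fintype.card ι : ℝ) * 8 ^ Fintype.card ι) ≤
      ∑ i : ι, ∑ d : ι → Bool, ∑ r : ι → Bool, ∑ s : ι → Bool,
        ((if Z (τ (plantPair d r s i false).1 (plantPair d r s i false).2) then (1 : ℝ) else 0) -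
          (if Z (τ (plantPair d r s i true).1 (plantPair d r s i true).2) then 1 else 0))) :
    (Fintype.card ι : ℝ) ≤ 55296 * Real.log (Fintype.card T) := by
  set m := Fintype.card ι with hm
  let f : T → (ι → Bool) → ℝ := fun t x => if ∃ y, τ x y = t then 1 else 0
  let g : T → (ι → Bool) → ℝ := fun t y => if ∃ x, τ x y = t then 1 else 0
  have f0 : ∀ t r, 0 ≤ f t r := fun t r => by simp only [f]; split_ifs <;> norm_num
  have f1 : ∀ t r, f t r ≤ 1 := fun t r => by simp only [f]; split_ifs <;> norm_num
  have g0 : ∀ t r, 0 ≤ g t r := fun t r => by simp only [g]; split_ifs <;> norm_num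
  have g1 : ∀ t r, g t r ≤ 1 := fun t r => by simp only [g]; split_ifs <;> norm_num
  have hfg : ∀ t x y, f t x * g t y = if τ x y = t then 1 else 0 := by
    intro t x y
    simp only [f, g, hτ.eq_iff t x y]
    by_cases h1 : ∃ y', τ x y' = t <;> by_cases h2 : ∃ x', τ x' y = t <;> simp [h1, h2]
  have hpart : ∀ x y, ∑ t, f t x * g t y = 1 := by
    intro x y
    simp [hfg]
  have hZ : ∀ x y, (if Z (τ x y) then (1 : ℝ) else 0) =
      ∑ t, if Z t then f t x * g t y else 0 := by
    intro x y
    simp only [hfg]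
    rw [Finset.sum_eq_single (τ x y)]
    · simp
    · intro t _ ht
      simp [ht.symm]
    · simp
  have hA := sum_plantSum_biased_le f g f0 f1 g0 g1 hpart (ε := 1 / 12) (by norm_num)
  have hB := sum_plantSum_biased_le g f g0 g1 f0 f1
    (fun x y => by simpa only [mul_comm] using hpart y x) (ε := 1 / 12) (by norm_num)
  set F : T → (ι → Bool) → ι → Bool → ℝ := fun t d i b => plantSum (f t) d i b with hF
  set G : T → (ι → Bool) → ι → Bool → ℝ := fun t d i b => plantSum (g t) d i b with hG
  have F0 : ∀ t d i b, 0 ≤ F t d i b := fun t d i b => plantSum_nonneg (f0 t) d i b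
  have G0 : ∀ t d i b, 0 ≤ G t d i b := fun t d i b => plantSum_nonneg (g0 t) d i b
  have hprod : ∀ i d b, ∑ r : ι → Bool, ∑ s : ι → Bool,
      (if Z (τ (plantPair d r s i b).1 (plantPair d r s i b).2) then (1 : ℝ) else 0) =
      ∑ t, if Z t then F t d i b * G t (notBits d) i b else 0 := by
    intro i d b
    simp only [hZ, hF, hG, plantSum, Finset.sum_mul_sum]
    rw [Finset.sum_congr rfl fun r _ => Finset.sum_comm, Finset.sum_comm]
    refine Finset.sum_congr rfl fun t _ => ?_
    by_cases hz : Z t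
    · simp only [hz, if_true]
      rfl
    · simp [hz]
  have hone : ∀ i d, ∑ t, F t d i false * G t (notBits d) i false = 4 ^ m := by
    intro i d
    simp only [hF, hG, plantSum, Finset.sum_mul_sum]
    rw [Finset.sum_comm]
    rw [Finset.sum_congr rfl fun r _ => Finset.sum_comm]
    simp only [hpart, Finset.sum_const, Finset.card_univ, Fintype.card_pi, Fintype.card_bool,
      Finset.prod_const, nsmul_eq_mul, mul_one]
    push_cast
    rw [← hm, ← mul_pow]; norm_num
  let badF : T → (ι → Bool) → ι → ℝ := fun t d i =>
    if F t d i true < (1 - 1 / 12) * F t d i false then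
      F t d i false * G t (notBits d) i false else 0
  let badG : T → (ι → Bool) → ι → ℝ := fun t d i =>
    if G t d i true < (1 - 1 / 12) * G t d i false then
      G t d i false * F t (notBits d) i false else 0
  have bF0 : ∀ t d i, 0 ≤ badF t d i := by
    intro t d i
    simp only [badF]
    split_ifs
    · exact mul_nonneg (F0 _ _ _ _) (G0 _ _ _ _)
    · exact le_rfl
  have bG0 : ∀ t d i, 0 ≤ badG t d i := by
    intro t d i
    simp only [badG]
    split_ifs
    · exact mul_nonneg (G0 _ _ _ _) (F0 _ _ _ _)
    · exact le_rfl
  have hnn : ∀ d : ι → Bool, notBits (notBits d) = d := fun d => by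
    funext i
    simp [notBits]
  -- Where neither factor is biased, `F 1 * G 1 ≥ (11 / 12) ^ 2 * (F 0 * G 0)`.
  have hpoint : ∀ i d t, (if Z t then F t d i false * G t (notBits d) i false else 0) -
      (if Z t then F t d i true * G t (notBits d) i true else 0) ≤
      1 / 6 * (F t d i false * G t (notBits d) i false) + badF t d i + badG t (notBits d) i := by
    intro i d t
    have a0 := F0 t d i false
    have a1 := F0 t d i true
    have b0 := G0 t (notBits d) i false
    have b1 := G0 t (notBits d) i true
    have c0 := bF0 t d i
    have c1 := bG0 t (notBits d) i
    have ab := mul_nonneg a0 b0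
    have ab' := mul_nonneg a1 b1
    by_cases hz : Z t
    · simp only [hz, if_true]
      by_cases h1 : F t d i true < (1 - 1 / 12) * F t d i false
      · have : badF t d i = F t d i false * G t (notBits d) i false := by simp only [badF, if_pos h1]
        linarith
      by_cases h2 : G t (notBits d) i true < (1 - 1 / 12) * G t (notBits d) i false
      · have : badG t (notBits d) i = G t (notBits d) i false * F t d i false := by
          simp only [badG, if_pos h2, hnn]
        linarith [mul_comm (G t (notBits d) i false) (F t d i false)]
      · rw [not_lt] at h1 h2
        have := mul_le_mul h1 h2 (by positivity) a1
        linarith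
    · simp only [hz, if_false]
      linarith
  have hsumG : ∑ t, ∑ i, ∑ d, badG t (notBits d) i = ∑ t, ∑ i, ∑ d, badG t d i := by
    refine Finset.sum_congr rfl fun t _ => Finset.sum_congr rfl fun i _ => ?_
    exact Equiv.sum_comp (Function.Involutive.toPerm notBits hnn) fun d => badG t d i
  have hA' : ∑ t, ∑ i, ∑ d, badF t d i ≤ 4608 * (8 ^ m * Real.log (Fintype.card T)) :=
    hA.trans_eq (by rw [← hm]; norm_num)
  have hB' : ∑ t, ∑ i, ∑ d, badG t d i ≤ 4608 * (8 ^ m * Real.log (Fintype.card T)) :=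
    hB.trans_eq (by rw [← hm]; norm_num)
  have hswap : ∀ h : T → (ι → Bool) → ι → ℝ,
      ∑ i, ∑ d, ∑ t, h t d i = ∑ t, ∑ i, ∑ d, h t d i := by
    intro h
    rw [Finset.sum_congr rfl fun i _ => Finset.sum_comm, Finset.sum_comm]
  have hub : ∑ i : ι, ∑ d : ι → Bool, ∑ r : ι → Bool, ∑ s : ι → Bool,
        ((if Z (τ (plantPair d r s i false).1 (plantPair d r s i false).2) then (1 : ℝ) else 0) -
          (if Z (τ (plantPair d r s i true).1 (plantPair d r s i true).2) then 1 else 0)) ≤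
      1 / 6 * (m * 8 ^ m) + 9216 * (8 ^ m * Real.log (Fintype.card T)) := by
    have e1 : ∀ i d, ∑ r : ι → Bool, ∑ s : ι → Bool,
        ((if Z (τ (plantPair d r s i false).1 (plantPair d r s i false).2) then (1 : ℝ) else 0) -
          (if Z (τ (plantPair d r s i true).1 (plantPair d r s i true).2) then 1 else 0)) ≤
        1 / 6 * 4 ^ m + ∑ t, badF t d i + ∑ t, badG t (notBits d) i := by
      intro i d
      simp only [Finset.sum_sub_distrib, hprod]
      rw [← Finset.sum_sub_distrib]
      refine (Finset.sum_le_sum fun t _ => hpoint i d t).trans_eq ?_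
      rw [Finset.sum_add_distrib, Finset.sum_add_distrib, ← Finset.mul_sum, hone]
    refine (Finset.sum_le_sum fun i _ => Finset.sum_le_sum fun d _ => e1 i d).trans ?_
    simp only [Finset.sum_add_distrib]
    rw [hswap, hswap fun t d i => badG t (notBits d) i, hsumG]
    have e2 : ∑ _i : ι, ∑ _d : ι → Bool, (1 : ℝ) / 6 * 4 ^ m = 1 / 6 * (m * 8 ^ m) := by
      simp only [Finset.sum_const, Finset.card_univ, Fintype.card_pi, Fintype.card_bool,
        Finset.prod_const, nsmul_eq_mul]
      rw [← hm]
      have : (8 : ℝ) ^ m = 2 ^ m * 4 ^ m := by rw [← mul_pow]; norm_num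
      rw [this]
      push_cast
      ring
    rw [e2]
    linarith
  have h8 : (0 : ℝ) < 8 ^ m := by positivity
  have hfin := hadv.trans hub
  have : (m : ℝ) * 8 ^ m ≤ 55296 * Real.log (Fintype.card T) * 8 ^ m := by linarith
  exact le_of_mul_le_mul_right this h8

end Communication

/-! ### Streaming algorithms as communication protocols -/

section Reduction

/-- If the first part of the stream depends on `x` only and the second one on `y` only, then the
memory after `p` passes is a function of a transcript of `2 * s * p` bits: the memories after each
part in each pass. -/
theorem exists_isRectangular_memoryAfter {n s : ℕ} (A : ALAlgorithm n s) {X Y : Type}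
    (SA : X → List (ALItem n)) (SB : Y → List (ALItem n)) (p : ℕ) :
    ∃ (T : Type) (_ : Fintype T) (τ : X → Y → T) (f : T → BitMemory s), IsRectangular τ ∧
      Fintype.card T = 2 ^ (2 * s * p) ∧
      ∀ x y, A.memoryAfter (SA x ++ SB y) p = f (τ x y) := by
  induction p with
  | zero =>
    refine ⟨Unit, inferInstance, fun _ _ => (), fun _ => A.init, fun _ _ _ _ _ => rfl, by simp, ?_⟩
    intro x y
    rfl
  | succ p ih =>
    obtain ⟨T, _, τ, f, hτ, hcard, hf⟩ := ih
    refine ⟨(T × BitMemory s) × BitMemory s, inferInstance, _, fun t => A.endPass p t.2,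
      (hτ.extend_left fun t x => (SA x).foldl (A.step p) (f t)).extend_right
        fun t y => (SB y).foldl (A.step p) t.2, ?_, ?_⟩
    · simp only [Fintype.card_prod, hcard, Fintype.card_pi, Fintype.card_bool, Finset.prod_const,
        Finset.card_univ, Fintype.card_fin]
      rw [← pow_add, ← pow_add]
      congr 1
      ring
    · intro x y
      simp only [ALAlgorithm.memoryAfter, List.foldl_append, hf]

open Classical in
/-- Averaging: some outcome lies in at least two thirds of finitely many events, if each of them has
probability at least `2 / 3`. -/
theorem exists_two_thirds_le_sum {α I : Type*} [Fintype I] (μ : PMF α) (E : I → Set α)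
    (h : ∀ i, 2 / 3 ≤ μ.toOuterMeasure (E i)) :
    ∃ a, 2 / 3 * (Fintype.card I : ℝ) ≤ ∑ i, if a ∈ E i then (1 : ℝ) else 0 := by
  by_contra! hcon
  let k : α → ℕ := fun a => ∑ i, if a ∈ E i then 1 else 0
  have hk : ∀ a, 3 * k a + 1 ≤ 2 * Fintype.card I := by
    intro a
    have h1 := hcon a
    have h2 : ((k a : ℕ) : ℝ) = ∑ i, if a ∈ E i then (1 : ℝ) else 0 := by
      simp [k]
    rw [← h2] at h1
    have h3 : (3 : ℝ) * k a < 2 * Fintype.card I := by linarith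
    exact_mod_cast h3
  have hsum : ∑ i, μ.toOuterMeasure (E i) = ∑' a, μ a * (k a : ENNReal) := by
    simp only [PMF.toOuterMeasure_apply]
    rw [← Summable.tsum_finsetSum fun _ _ => ENNReal.summable]
    refine tsum_congr fun a => ?_
    simp only [k, Nat.cast_sum, Finset.mul_sum]
    refine Finset.sum_congr rfl fun i _ => ?_
    by_cases ha : a ∈ E i <;> simp [ha]
  have hup : 3 * ∑ i, μ.toOuterMeasure (E i) + 1 ≤ 2 * (Fintype.card I : ENNReal) := by
    calc 3 * ∑ i, μ.toOuterMeasure (E i) + 1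
        = ∑' a, μ a * ((3 * k a + 1 : ℕ) : ENNReal) := by
          rw [hsum, ← ENNReal.tsum_mul_left, ← μ.tsum_coe, ← ENNReal.tsum_add]
          refine tsum_congr fun a => ?_
          push_cast
          ring
      _ ≤ ∑' a, μ a * ((2 * Fintype.card I : ℕ) : ENNReal) :=
          ENNReal.tsum_le_tsum fun a => by
            gcongr
            exact hk a
      _ = 2 * (Fintype.card I : ENNReal) := by
          rw [ENNReal.tsum_mul_right, μ.tsum_coe]
          push_cast
          ring
  have hlow : 2 * (Fintype.card I : ENNReal) ≤ 3 * ∑ i, μ.toOuterMeasure (E i) := by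
    calc 2 * (Fintype.card I : ENNReal) = 3 * ∑ _i : I, (2 / 3 : ENNReal) := by
          rw [Finset.sum_const, Finset.card_univ, nsmul_eq_mul, mul_left_comm,
            ENNReal.mul_div_cancel (by norm_num) (by norm_num), mul_comm]
      _ ≤ _ := by gcongr; exact h _
  have hfin : 2 * (Fintype.card I : ENNReal) ≠ ⊤ := by finiteness
  have hlt : 2 * (Fintype.card I : ENNReal) < 2 * (Fintype.card I : ENNReal) + 1 :=
    ENNReal.lt_add_right hfin one_ne_zero
  exact absurd (hlt.trans_le ((add_le_add_left hlow 1).trans hup)) (lt_irrefl _)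

open Classical in
/-- The part of a canonical adjacency-list stream of `G` that consists of the vertices in `B`. -/
noncomputable def streamPart {n : ℕ} (G : SimpleGraph (Fin n)) (B : Set (Fin n)) : List (ALItem n) :=
  ((List.finRange n).filter fun v => v ∈ B).map
    fun v => (v, (List.finRange n).filter fun w => G.Adj v w)

theorem streamPart_congr {n : ℕ} {G G' : SimpleGraph (Fin n)} {B : Set (Fin n)}
    (h : ∀ v ∈ B, ∀ w, G.Adj v w ↔ G'.Adj v w) : streamPart G B = streamPart G' B := by
  refine List.map_congr_left fun v hv => ?_
  have hv' : v ∈ B := by simpa using hv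
  exact Prod.ext rfl (List.filter_congr fun w _ => decide_eq_decide.2 (h v hv' w))

theorem isALStream_append_streamPart {n : ℕ} (G : SimpleGraph (Fin n)) (B : Set (Fin n)) :
    IsALStream G (streamPart G Bᶜ ++ streamPart G B) := by
  classical
  have hfst : ∀ C : Set (Fin n), (streamPart G C).map Prod.fst =
      (List.finRange n).filter fun v => v ∈ C := by
    intro C
    simp [streamPart, Function.comp_def]
  refine ⟨?_, ?_, ?_⟩
  · rw [List.map_append, hfst, hfst, List.nodup_append]
    refine ⟨(List.nodup_finRange n).filter _, (List.nodup_finRange n).filter _, ?_⟩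
    intro a ha b hb hab
    subst hab
    simp at ha hb
    exact ha hb
  · intro v
    rw [List.map_append, hfst, hfst]
    by_cases hv : v ∈ B <;> simp [hv]
  · intro item hitem
    have : ∃ v, item = (v, (List.finRange n).filter fun w => G.Adj v w) := by
      rcases List.mem_append.1 hitem with h | h <;>
      · obtain ⟨v, _, hv⟩ := List.mem_map.1 h
        exact ⟨v, hv.symm⟩
    obtain ⟨v, rfl⟩ := this
    exact ⟨(List.nodup_finRange n).filter _, fun w => by simp⟩

/-- A reduction from disjointness to Diameter. The graphs `G x y` are connected and `H`-free, the
neighbourhoods of the vertices outside `B` depend on `x` only and those of the vertices in `B` on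
`y` only, and membership of the diameter in `D` tells whether `x` and `y` are disjoint. -/
structure DisjointnessReduction {W : Type*} (H : SimpleGraph W) (n m : ℕ) where
  /-- The graph of two bit vectors. -/
  G : (Fin m → Bool) → (Fin m → Bool) → SimpleGraph (Fin n)
  /-- The vertices that arrive in the second part of the stream. -/
  B : Set (Fin n)
  adj_left : ∀ x y y', ∀ v ∈ Bᶜ, ∀ w, (G x y).Adj v w ↔ (G x y').Adj v w
  adj_right : ∀ x x' y, ∀ v ∈ B, ∀ w, (G x y).Adj v w ↔ (G x' y).Adj v w
  connected : ∀ x y, (G x y).Connected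
  free : ∀ x y, ¬ H.IsIndContained (G x y)
  /-- A set that contains the diameter exactly if the bit vectors are disjoint. -/
  D : Set ℕ∞
  mem_of_disjoint : ∀ x y, (∀ i, ¬ (x i = true ∧ y i = true)) → (G x y).ediam ∈ D
  notMem_of_intersect : ∀ x y i, x i = true → y i = true → (G x y).ediam ∉ D

theorem DisjointnessReduction.le_mul {W : Type*} {H : SimpleGraph W} {n m s p : ℕ}
    (R : DisjointnessReduction H n m) (𝒜 : PMF (ALAlgorithm n s))
    (h𝒜 : SolvesDiameterOnConnectedFree H 𝒜 p) : (m : ℝ) ≤ 110592 * (p * s) := by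
  classical
  let z : Fin m → Bool := fun _ => false
  let SA : (Fin m → Bool) → List (ALItem n) := fun x => streamPart (R.G x z) R.Bᶜ
  let SB : (Fin m → Bool) → List (ALItem n) := fun y => streamPart (R.G z y) R.B
  have hstream : ∀ x y, IsALStream (R.G x y) (SA x ++ SB y) := by
    intro x y
    have h1 : SA x = streamPart (R.G x y) R.Bᶜ := streamPart_congr (R.adj_left x z y)
    have h2 : SB y = streamPart (R.G x y) R.B := streamPart_congr (R.adj_right z x y)
    rw [h1, h2]
    exact isALStream_append_streamPart _ _
  let Cube := Fin m → Bool
  let pr : (Fin m × Cube × Cube × Cube) × Bool → Cube × Cube :=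
    fun c => plantPair c.1.2.1 c.1.2.2.1 c.1.2.2.2 c.1.1 c.2
  obtain ⟨E, hE⟩ : ∃ E : (Fin m × Cube × Cube × Cube) × Bool → Set (ALAlgorithm n s), ∀ c,
      E c = {A | A.run p (SA (pr c).1 ++ SB (pr c).2) = (R.G (pr c).1 (pr c).2).ediam} :=
    ⟨_, fun _ => rfl⟩
  obtain ⟨A, hA⟩ := exists_two_thirds_le_sum 𝒜 E fun c => by
    rw [hE]
    exact h𝒜 _ (R.connected _ _) (R.free _ _) _ (hstream _ _)
  obtain ⟨T, _, τ, f, hτ, hcard, hf⟩ := exists_isRectangular_memoryAfter A SA SB p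
  let Z : T → Prop := fun t => A.output (f t) ∈ R.D
  have hrun : ∀ x y, A.run p (SA x ++ SB y) = A.output (f (τ x y)) := by
    intro x y
    rw [ALAlgorithm.run, hf]
  have hfalse : ∀ (i : Fin m) (d r s : Cube),
      (if A ∈ E ((i, d, r, s), false) then (1 : ℝ) else 0) ≤
      if Z (τ (plantPair d r s i false).1 (plantPair d r s i false).2) then 1 else 0 := by
    intro i d r s
    have hdisj : ∀ j, ¬ ((plantPair d r s i false).1 j = true ∧
        (plantPair d r s i false).2 j = true) := by
      intro j
      by_cases hj : j = i
      · subst hj; simp [plantPair]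
      · cases hd : d j <;> simp [plantPair, maskBits, notBits, hj, hd]
    have hD := R.mem_of_disjoint _ _ hdisj
    split_ifs with h1 h2 h2
    · exact le_rfl
    · rw [hE, Set.mem_ofPred_eq, hrun] at h1
      change _ = (R.G (plantPair _ _ _ _ _).1 (plantPair _ _ _ _ _).2).ediam at h1
      rw [← h1] at hD
      exact absurd hD h2
    · exact zero_le_one
    · exact le_rfl
  have htrue : ∀ (i : Fin m) (d r s : Cube),
      (if A ∈ E ((i, d, r, s), true) then (1 : ℝ) else 0) ≤
      1 - if Z (τ (plantPair d r s i true).1 (plantPair d r s i true).2) then 1 else 0 := by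
    intro i d r s
    have hD := R.notMem_of_intersect (plantPair d r s i true).1 (plantPair d r s i true).2 i
      (by simp [plantPair]) (by simp [plantPair])
    split_ifs with h1 h2 h2
    · rw [hE, Set.mem_ofPred_eq, hrun] at h1
      change _ = (R.G (plantPair _ _ _ _ _).1 (plantPair _ _ _ _ _).2).ediam at h1
      rw [← h1] at hD
      exact absurd h2 hD
    · norm_num
    · norm_num
    · norm_num
  have hmain := card_le_log_of_isRectangular hτ Z (by
    rw [Fintype.sum_prod_type] at hA
    simp only [Fintype.sum_prod_type, Fintype.sum_bool] at hA
    have hle := hA.trans (Finset.sum_le_sum fun i _ => Finset.sum_le_sum fun d _ =>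
      Finset.sum_le_sum fun r _ => Finset.sum_le_sum fun s _ =>
        add_le_add (htrue i d r s) (hfalse i d r s))
    simp only [Fintype.card_prod, Fintype.card_fin, Fintype.card_bool, Fintype.card_pi,
      Finset.prod_const, Finset.card_univ, Cube] at hle
    have hsplit : ∀ a b : Fin m → Cube → Cube → Cube → ℝ,
        ∑ i, ∑ d, ∑ r, ∑ s, (1 - a i d r s + b i d r s) =
        m * 8 ^ m + ∑ i, ∑ d, ∑ r, ∑ s, (b i d r s - a i d r s) := by
      intro a b
      have h8 : (m : ℝ) * 8 ^ m = ∑ _i : Fin m, ∑ _d : Cube, ∑ _r : Cube, ∑ _s : Cube, (1 : ℝ) := by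
        have : (8 : ℝ) ^ m = 2 ^ m * (2 ^ m * 2 ^ m) := by rw [← mul_pow, ← mul_pow]; norm_num
        simp [Cube, this]
      rw [h8]
      simp only [← Finset.sum_add_distrib]
      refine Finset.sum_congr rfl fun i _ => Finset.sum_congr rfl fun d _ =>
        Finset.sum_congr rfl fun r _ => Finset.sum_congr rfl fun s _ => ?_
      ring
    rw [hsplit] at hle
    have h8 : (8 : ℝ) ^ m = 2 ^ m * (2 ^ m * 2 ^ m) := by rw [← mul_pow, ← mul_pow]; norm_num
    push_cast at hle
    rw [← h8] at hle
    rw [Fintype.card_fin]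
    linarith)
  rw [hcard, Fintype.card_fin] at hmain
  push_cast at hmain
  rw [Real.log_pow] at hmain
  have hlog : Real.log 2 ≤ 1 := by linarith [Real.log_two_lt_d9]
  have h2 : (((2 * s * p : ℕ) : ℝ)) * Real.log 2 ≤ ((2 * s * p : ℕ) : ℝ) * 1 :=
    mul_le_mul_of_nonneg_left hlog (Nat.cast_nonneg _)
  push_cast at h2 hmain
  linarith

end Reduction

/-! ### Graphs given by kinds of vertices -/

section KindGraphs

/-- A potential that changes by at most `1` along each edge bounds distances from
below. -/
theorem le_add_edist_of_adj {V : Type*} {G : SimpleGraph V} (f : V → ℕ)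
    (hf : ∀ v w, G.Adj v w → f v ≤ f w + 1) (v w : V) : (f v : ℕ∞) ≤ f w + G.edist v w := by
  by_cases htop : G.edist v w = ⊤
  · simp [htop]
  · obtain ⟨p, hp⟩ := SimpleGraph.exists_walk_of_edist_ne_top htop
    rw [← hp]
    have : ∀ {a b : V} (q : G.Walk a b), f a ≤ f b + q.length := by
      intro a b q
      induction q with
      | nil => simp
      | cons h q ih =>
        have := hf _ _ h
        rw [SimpleGraph.Walk.length_cons]
        omega
    exact_mod_cast this p

/-- The graph on `V` in which the adjacency of two vertices is decided by a symmetric relation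
between their kinds. Vertices of the same kind `k` are adjacent twins if `R k k` holds, and
nonadjacent twins otherwise. -/
def kindGraph {V K : Type*} (R : K → K → Prop) (hR : ∀ k l, R k l → R l k) (π : V → K) :
    SimpleGraph V where
  Adj v w := v ≠ w ∧ R (π v) (π w)
  symm := ⟨fun _ _ h => ⟨h.1.symm, hR _ _ h.2⟩⟩
  loopless := ⟨fun _ h => h.1 rfl⟩

variable {V K : Type*} {R : K → K → Prop} {hR : ∀ k l, R k l → R l k} {π : V → K}

theorem kindGraph_adj {v w : V} : (kindGraph R hR π).Adj v w ↔ v ≠ w ∧ R (π v) (π w) := Iff.rfl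

theorem kindGraph_edist_le_one {v w : V} (h : R (π v) (π w)) :
    (kindGraph R hR π).edist v w ≤ 1 := by
  rw [SimpleGraph.edist_le_one_iff_adj_or_eq]
  by_cases hvw : v = w
  · exact Or.inr hvw
  · exact Or.inl ⟨hvw, h⟩

theorem kindGraph_edist_le_succ {ψ : K → V} (hψ : ∀ k, π (ψ k) = k) {v w : V} {k : K} {j : ℕ}
    (h : R (π v) k) (hk : (kindGraph R hR π).edist (ψ k) w ≤ j) :
    (kindGraph R hR π).edist v w ≤ (j + 1 : ℕ) := by
  have h1 : (kindGraph R hR π).edist v (ψ k) ≤ 1 := kindGraph_edist_le_one (by rwa [hψ])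
  refine SimpleGraph.edist_triangle.trans ((add_le_add h1 hk).trans_eq ?_)
  push_cast
  rw [add_comm]

theorem kindGraph_edist_le_two {ψ : K → V} (hψ : ∀ k, π (ψ k) = k) {v w : V} (k : K)
    (h : R (π v) k) (h' : R k (π w)) : (kindGraph R hR π).edist v w ≤ 2 :=
  kindGraph_edist_le_succ (j := 1) hψ h (kindGraph_edist_le_one (by rwa [hψ]))

theorem kindGraph_edist_le_three {ψ : K → V} (hψ : ∀ k, π (ψ k) = k) {v w : V} (k l : K)
    (h : R (π v) k) (h' : R k l) (h'' : R l (π w)) : (kindGraph R hR π).edist v w ≤ 3 :=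
  kindGraph_edist_le_succ (j := 2) hψ h (kindGraph_edist_le_two hψ l (by rwa [hψ]) h'')

/-- A potential on the kinds that changes by at most `1` along related kinds bounds the diameter
from below. -/
theorem kindGraph_le_add_ediam {ψ : K → V} (hψ : ∀ k, π (ψ k) = k) (f : K → ℕ)
    (hf : ∀ k l, R k l → f k ≤ f l + 1) (k l : K) :
    (f k : ℕ∞) ≤ f l + (kindGraph R hR π).ediam := by
  have h := le_add_edist_of_adj (G := kindGraph R hR π) (fun v => f (π v))
    (fun v w hvw => hf _ _ hvw.2) (ψ k) (ψ l)
  simp only [hψ] at h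
  exact h.trans (add_le_add le_rfl SimpleGraph.edist_le_ediam)

theorem ediam_le_of_edist_center_le {G : SimpleGraph V} (c : V) {j : ℕ}
    (h : ∀ v, G.edist v c ≤ j) : G.ediam ≤ (2 * j : ℕ) := by
  refine SimpleGraph.ediam_le_of_edist_le fun u v => ?_
  refine SimpleGraph.edist_triangle.trans ((add_le_add (h u)
    ((SimpleGraph.edist_comm).trans_le (h v))).trans_eq ?_)
  push_cast
  rw [two_mul]

theorem connected_of_edist_center_le {G : SimpleGraph V} (c : V) {j : ℕ}
    (h : ∀ v, G.edist v c ≤ j) : G.Connected := by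
  have : Nonempty V := ⟨c⟩
  refine SimpleGraph.connected_of_ediam_ne_top fun htop => ?_
  have := ediam_le_of_edist_center_le c h
  rw [htop, top_le_iff] at this
  exact ENat.natCast_ne_top _ this

/-- Vertices can be given kinds so that each kind occurs, and only the kind `k₀` is repeated. -/
theorem exists_kinds {V K : Type*} (ψ : K → V) (hψ : Function.Injective ψ) (k₀ : K) :
    ∃ π : V → K, (∀ k, π (ψ k) = k) ∧ ∀ v, π v ≠ k₀ → ψ (π v) = v := by
  refine ⟨Function.extend ψ id fun _ => k₀, fun k => hψ.extend_apply _ _ _, fun v hv => ?_⟩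
  by_cases h : ∃ k, ψ k = v
  · obtain ⟨k, rfl⟩ := h
    rw [hψ.extend_apply]
    rfl
  · exact absurd (Function.extend_apply' _ _ _ h) hv

end KindGraphs

/-! ### Trees -/

section Trees

/-- A graph is acyclic if its vertices have heights such that adjacent vertices have different
heights and no vertex has two neighbours below it. -/
theorem isAcyclic_of_height {V : Type*} {G : SimpleGraph V} (h : V → ℕ)
    (hne : ∀ v w, G.Adj v w → h v ≠ h w)
    (huniq : ∀ v w w', G.Adj v w → G.Adj v w' → h w < h v → h w' < h v → w = w') :
    G.IsAcyclic := by
  classical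
  intro a c hc
  -- A cycle cannot pass through its highest vertex.
  obtain ⟨u, hu, hmax⟩ := c.support.toFinset.exists_max_image h ⟨a, by simp⟩
  rw [List.mem_toFinset] at hu
  have hc' := hc.rotate hu
  set c' := c.rotate u hu with hcdef
  have hle : ∀ w ∈ c'.support, h w ≤ h u := by
    intro w hw
    refine hmax w ?_
    rw [List.mem_toFinset]
    exact (SimpleGraph.Walk.mem_support_rotate_iff c u hu).1 hw
  have hnn : ¬ c'.Nil := hc'.not_nil
  have h1 := c'.adj_snd hnn
  have h2 := (c'.adj_penultimate hnn).symm
  have l1 := hle _ (c'.getVert_mem_support 1)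
  have l2 := hle _ (c'.getVert_mem_support (c'.length - 1))
  exact hc'.snd_ne_penultimate (huniq u _ _ h1 h2 (lt_of_le_of_ne l1 (hne _ _ h1).symm)
    (lt_of_le_of_ne l2 (hne _ _ h2).symm))

/-- The kinds of vertices of the trees: a root with two children `left` and `right`, a path
`path₁`, `path₂`, `path₃` from the root, and for each index a vertex `u i` that hangs off `left` or
the root, its child `v i`, and a vertex `z i` that hangs off `v i` or `right`. -/
inductive TreeKind (m : ℕ) : Type
  | root | left | right | path₁ | path₂ | path₃
  | u (i : Fin m) | v (i : Fin m) | z (i : Fin m)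

namespace TreeKind

variable {m : ℕ}

/-- The parent of a vertex. Index `i` gives a branch of depth `4` only if `x i` and `y i` are both
`true`. -/
def parent (x y : Fin m → Bool) : TreeKind m → Option (TreeKind m)
  | root => none
  | left => some root
  | right => some root
  | path₁ => some root
  | path₂ => some path₁
  | path₃ => some path₂
  | u i => some (if x i then left else root)
  | v i => some (u i)
  | z i => some (if y i then v i else right)

/-- A height that exceeds the height of the parent for all bit vectors. -/
def height : TreeKind m → ℕ
  | root => 0
  | left => 1
  | right => 1
  | path₁ => 1
  | path₂ => 2
  | path₃ => 3
  | u _ => 2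
  | v _ => 3
  | z _ => 4

/-- One of the kinds is the parent of the other. -/
def Rel (x y : Fin m → Bool) (k l : TreeKind m) : Prop :=
  parent x y k = some l ∨ parent x y l = some k

theorem Rel.symm {x y : Fin m → Bool} (k l : TreeKind m) (h : Rel x y k l) : Rel x y l k :=
  Or.symm h

theorem height_lt_of_parent {x y : Fin m → Bool} {k l : TreeKind m} (h : parent x y k = some l) :
    height l < height k := by
  cases k <;> simp only [parent, Option.some.injEq, reduceCtorEq] at h <;> subst h <;>
    (try split_ifs) <;> simp [height]

/-- An enumeration of the kinds. -/
def code : TreeKind m → ℕ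
  | root => 0
  | left => 1
  | right => 2
  | path₁ => 3
  | path₂ => 4
  | path₃ => 5
  | u i => 3 * i + 6
  | v i => 3 * i + 7
  | z i => 3 * i + 8

theorem code_injective : Function.Injective (code : TreeKind m → ℕ) := by
  intro k l h
  cases k <;> cases l <;> simp only [code] at h <;> first | rfl | omega | (congr 1; omega)

theorem code_lt (k : TreeKind m) : code k < 3 * m + 6 := by
  cases k <;> simp only [code] <;> omega

/-- The kinds that arrive in the second part of the stream. -/
def IsRight : TreeKind m → Prop
  | right | v _ | z _ => True
  | _ => False

theorem rel_congr_right (x y y' : Fin m → Bool) {k : TreeKind m} (hk : ¬ IsRight k)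
    (l : TreeKind m) : Rel x y k l ↔ Rel x y' k l := by
  cases k <;> simp only [IsRight, not_true_eq_false] at hk <;> cases l <;>
    simp only [Rel, parent, Option.some.injEq, reduceCtorEq, or_false, false_or] <;>
    (split_ifs <;> simp)

theorem rel_congr_left (x x' y : Fin m → Bool) {k : TreeKind m} (hk : IsRight k)
    (l : TreeKind m) : Rel x y k l ↔ Rel x' y k l := by
  cases k <;> simp only [IsRight] at hk <;> cases l <;>
    simp only [Rel, parent, Option.some.injEq, reduceCtorEq, or_false, false_or] <;>
    (split_ifs <;> simp)

/-- The depth of a vertex. -/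
def depth (x y : Fin m → Bool) : TreeKind m → ℕ
  | root => 0
  | left => 1
  | right => 1
  | path₁ => 1
  | path₂ => 2
  | path₃ => 3
  | u i => if x i then 2 else 1
  | v i => if x i then 3 else 2
  | z i => if y i then (if x i then 4 else 3) else 2

theorem depth_eq_of_parent {x y : Fin m → Bool} {k l : TreeKind m} (h : parent x y k = some l) :
    depth x y k = depth x y l + 1 := by
  cases k <;> simp only [parent, Option.some.injEq, reduceCtorEq] at h <;> subst h <;>
    simp only [depth] <;> (try split_ifs) <;> simp [*]

/-- The depth of a vertex shifted by `3`, continued along the path to the values `2`, `1`, `0`. -/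
def potential (x y : Fin m → Bool) : TreeKind m → ℕ
  | path₁ => 2
  | path₂ => 1
  | path₃ => 0
  | k => depth x y k + 3

theorem potential_le {x y : Fin m → Bool} (k l : TreeKind m) (h : Rel x y k l) :
    potential x y k ≤ potential x y l + 1 := by
  rcases h with h | h
  · cases k <;> simp only [parent, Option.some.injEq, reduceCtorEq] at h <;> subst h <;>
      (try split_ifs) <;> simp [potential, depth, *] <;>
      split_ifs <;> simp
  · cases l <;> simp only [parent, Option.some.injEq, reduceCtorEq] at h <;> subst h <;>
      (try split_ifs) <;> simp [potential, depth, *] <;>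
      split_ifs <;> simp

theorem isAcyclic {n : ℕ} {x y : Fin m → Bool} {π : Fin n → TreeKind m} {ψ : TreeKind m → Fin n}
    (hπ : ∀ v, π v ≠ path₃ → ψ (π v) = v) :
    (kindGraph (Rel x y) Rel.symm π).IsAcyclic := by
  have hlow : ∀ k l, Rel x y k l → height l < height k → parent x y k = some l := by
    intro k l h hlt
    rcases h with h | h
    · exact h
    · exact absurd (height_lt_of_parent h) (by omega)
  have hleaf : ∀ k, parent x y k ≠ some path₃ := by
    intro k
    cases k <;> simp only [parent, ne_eq, Option.some.injEq, reduceCtorEq, not_false_eq_true] <;>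
      split_ifs <;> simp
  refine isAcyclic_of_height (fun v => height (π v)) ?_ ?_
  · rintro v w ⟨-, h | h⟩ heq
    · exact (height_lt_of_parent h).ne heq.symm
    · exact (height_lt_of_parent h).ne heq
  · rintro v w w' ⟨-, h⟩ ⟨-, h'⟩ hlt hlt'
    have e := hlow _ _ h hlt
    have e' := hlow _ _ h' hlt'
    have hw : π w ≠ path₃ := fun hc => hleaf (π v) (hc ▸ e)
    have heq : π w = π w' := Option.some.inj (e.symm.trans e')
    rw [← hπ w hw, ← hπ w' (heq ▸ hw), heq]

theorem edist_root_le_depth {n : ℕ} {x y : Fin m → Bool} {π : Fin n → TreeKind m}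
    {ψ : TreeKind m → Fin n} (hψ : ∀ k, π (ψ k) = k) (hπ : ∀ v, π v ≠ path₃ → ψ (π v) = v)
    (w : Fin n) : (kindGraph (Rel x y) Rel.symm π).edist w (ψ root) ≤ depth x y (π w) := by
  induction hk : height (π w) using Nat.strong_induction_on generalizing w with
  | _ j ih =>
    rcases hp : parent x y (π w) with _ | l
    · have hroot : π w = root := by
        revert hp
        cases π w <;> simp [parent]
      have hw : ψ root = w := by rw [← hroot]; exact hπ w (by simp [hroot])
      rw [hw, SimpleGraph.edist_self]
      exact zero_le
    · rw [depth_eq_of_parent hp]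
      refine kindGraph_edist_le_succ hψ (Or.inl hp) ?_
      have := ih (height l) (hk ▸ height_lt_of_parent hp) (ψ l) (by rw [hψ])
      rwa [hψ] at this

theorem depth_le_four (x y : Fin m → Bool) (k : TreeKind m) : depth x y k ≤ 4 := by
  cases k <;> simp only [depth] <;> (try split_ifs) <;> simp

theorem depth_le_three {x y : Fin m → Bool} (h : ∀ i, ¬ (x i = true ∧ y i = true))
    (k : TreeKind m) : depth x y k ≤ 3 := by
  cases k <;> simp only [depth] <;> (try split_ifs) <;> simp
  exact h _ ⟨by assumption, by assumption⟩

end TreeKind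

/-- Diameter is hard on trees: the diameter is at most `6` for disjoint bit vectors, and at least
`7` otherwise, because of a vertex of depth `4` and the end of the path of length `3`. -/
theorem exists_reduction_of_not_isAcyclic {W : Type*} {H : SimpleGraph W} (hH : ¬ H.IsAcyclic)
    {n m : ℕ} (hn : 3 * m + 6 ≤ n) : Nonempty (DisjointnessReduction H n m) := by
  obtain ⟨ψ, hinj⟩ : ∃ ψ : TreeKind m → Fin n, Function.Injective ψ :=
    ⟨fun k => ⟨k.code, k.code_lt.trans_le hn⟩,
      fun k l h => TreeKind.code_injective (Fin.mk.inj_iff.1 h)⟩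
  obtain ⟨π, hψ, hπ⟩ := exists_kinds ψ hinj .path₃
  have hdist := fun (x y : Fin m → Bool) => TreeKind.edist_root_le_depth (x := x) (y := y) hψ hπ
  refine ⟨{
    G := fun x y => kindGraph (TreeKind.Rel x y) TreeKind.Rel.symm π
    B := {v | (π v).IsRight}
    adj_left := fun x y y' v hv w => by
      rw [kindGraph_adj, kindGraph_adj, TreeKind.rel_congr_right x y y' hv]
    adj_right := fun x x' y v hv w => by
      rw [kindGraph_adj, kindGraph_adj, TreeKind.rel_congr_left x x' y hv]
    connected := fun x y => connected_of_edist_center_le _ (j := 4) fun v =>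
      (hdist x y v).trans (by exact_mod_cast TreeKind.depth_le_four x y _)
    free := fun x y ⟨e⟩ => hH ((TreeKind.isAcyclic hπ).embedding e)
    D := {d | d ≤ 6}
    mem_of_disjoint := fun x y hxy => ediam_le_of_edist_center_le _ (j := 3) fun v =>
      (hdist x y v).trans (by exact_mod_cast TreeKind.depth_le_three hxy _)
    notMem_of_intersect := fun x y i hx hy hD => ?_ }⟩
  have h7 := kindGraph_le_add_ediam (hR := TreeKind.Rel.symm) hψ (TreeKind.potential x y)
    TreeKind.potential_le (.z i) .path₃
  simp only [TreeKind.potential, TreeKind.depth, hx, hy, if_true] at h7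
  have h8 := h7.trans (add_le_add le_rfl hD)
  norm_num at h8

end Trees

/-! ### Claw-free graphs -/

section ClawFree

/-- The graph contains an induced claw `K_{1,3}` with centre `c`. -/
def HasClaw {V : Type*} (G : SimpleGraph V) : Prop :=
  ∃ c a b d, G.Adj c a ∧ G.Adj c b ∧ G.Adj c d ∧ a ≠ b ∧ a ≠ d ∧ b ≠ d ∧
    ¬ G.Adj a b ∧ ¬ G.Adj a d ∧ ¬ G.Adj b d

theorem HasClaw.of_embedding {V W : Type*} {G : SimpleGraph V} {H : SimpleGraph W} (e : H ↪g G)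
    (h : HasClaw H) : HasClaw G := by
  obtain ⟨c, a, b, d, h⟩ := h
  exact ⟨e c, e a, e b, e d, by simpa only [e.map_adj_iff, ne_eq, e.injective.eq_iff] using h⟩

/-- The kinds of vertices on one side of the claw-free graphs: a hub, a tip, and one core vertex for
each index. -/
inductive SideKind (m : ℕ) : Type
  | hub | tip | core (i : Fin m)

namespace SideKind

variable {m : ℕ}

/-- The vertices of one side other than the hub form two cliques, according to their bit. -/
def bit (x : Fin m → Bool) : SideKind m → Bool
  | hub => true
  | tip => true
  | core i => x i

/-- On each of the two sides, the hub is adjacent to all vertices, and the other vertices are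
adjacent if they have the same bit. The two core vertices of an index are joined across. -/
def Rel (x y : Fin m → Bool) (k l : Bool × SideKind m) : Prop :=
  (k.1 = l.1 ∧ (k.2 = hub ∨ l.2 = hub ∨
    bit (if k.1 then y else x) k.2 = bit (if k.1 then y else x) l.2)) ∨
  (k.1 ≠ l.1 ∧ ∃ i, k.2 = core i ∧ l.2 = core i)

theorem Rel.symm {x y : Fin m → Bool} (k l : Bool × SideKind m) (h : Rel x y k l) :
    Rel x y l k := by
  rcases h with ⟨h, h'⟩ | ⟨h, i, h1, h2⟩
  · refine Or.inl ⟨h.symm, ?_⟩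
    rw [← h]
    tauto
  · exact Or.inr ⟨h.symm, i, h2, h1⟩

theorem rel_of_rel_claw {x y : Fin m → Bool} {c a b d : Bool × SideKind m} (ha : Rel x y c a)
    (hb : Rel x y c b) (hd : Rel x y c d) : Rel x y a b ∨ Rel x y a d ∨ Rel x y b d := by
  obtain ⟨sc, c⟩ := c
  obtain ⟨sa, a⟩ := a
  obtain ⟨sb, b⟩ := b
  obtain ⟨sd, d⟩ := d
  have pig : ∀ p q r : Bool, p = q ∨ p = r ∨ q = r := by decide
  simp only [Rel] at ha hb hd ⊢
  cases sc <;> cases sa <;> cases sb <;> cases sd <;> simp at ha hb hd ⊢ <;>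
    grind [pig (bit x a) (bit x b) (bit x d), pig (bit y a) (bit y b) (bit y d)]

/-- An enumeration of the kinds. -/
def code : Bool × SideKind m → ℕ
  | (b, hub) => b.toNat
  | (b, tip) => 2 + b.toNat
  | (b, core i) => 2 * i + 4 + b.toNat

theorem code_injective : Function.Injective (code : Bool × SideKind m → ℕ) := by
  rintro ⟨b, k⟩ ⟨c, l⟩ h
  cases b <;> cases c <;> cases k <;> cases l <;> simp only [code, Bool.toNat] at h <;>
    first | rfl | (simp at h; omega) |
      (simp only [cond_true, cond_false] at h; omega) |
      (have : ∀ i j : Fin m, (i : ℕ) = j → i = j := fun i j => Fin.ext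
       simp at h; rw [this _ _ h])

theorem code_lt (k : Bool × SideKind m) : code k < 2 * m + 4 := by
  obtain ⟨b, k⟩ := k
  cases b <;> cases k <;> (simp [code]; try omega)

theorem rel_congr_right (x y y' : Fin m → Bool) {k : Bool × SideKind m} (hk : k.1 = false)
    (l : Bool × SideKind m) : Rel x y k l ↔ Rel x y' k l := by
  simp only [Rel, hk]
  simp

theorem rel_congr_left (x x' y : Fin m → Bool) {k : Bool × SideKind m} (hk : k.1 = true)
    (l : Bool × SideKind m) : Rel x y k l ↔ Rel x' y k l := by
  simp only [Rel, hk]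
  simp

/-- For disjoint bit vectors, a lower bound for the distance from the tip on the first side. -/
def potential (x y : Fin m → Bool) : Bool × SideKind m → ℕ
  | (false, tip) => 0
  | (false, hub) => 1
  | (false, core i) => if x i then 1 else 2
  | (true, tip) => 4
  | (true, hub) => 3
  | (true, core i) => if y i then 3 else 2

theorem potential_le {x y : Fin m → Bool} (hxy : ∀ i, ¬ (x i = true ∧ y i = true))
    (k l : Bool × SideKind m) (h : Rel x y k l) : potential x y k ≤ potential x y l + 1 := by
  obtain ⟨b, k⟩ := k
  obtain ⟨c, l⟩ := l
  cases b <;> cases c <;> cases k <;> cases l <;> simp [Rel, bit] at h <;>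
    simp only [potential] <;> (try split_ifs) <;> grind

variable {n : ℕ} {x y : Fin m → Bool} {π : Fin n → Bool × SideKind m}
  {ψ : Bool × SideKind m → Fin n}

theorem edist_hub_le (i₀ : Fin m) (hψ : ∀ k, π (ψ k) = k) (v : Fin n) :
    (kindGraph (Rel x y) Rel.symm π).edist v (ψ (false, hub)) ≤ (4 : ℕ) := by
  rcases hv : π v with ⟨_ | _, k⟩
  · have h1 : (kindGraph (Rel x y) Rel.symm π).edist v (ψ (false, hub)) ≤ 1 :=
      kindGraph_edist_le_one (by rw [hv, hψ]; simp [Rel])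
    exact h1.trans (by norm_num)
  · refine kindGraph_edist_le_succ (j := 3) (k := (true, hub)) hψ (by rw [hv]; simp [Rel]) ?_
    refine kindGraph_edist_le_three hψ (true, core i₀) (false, core i₀) ?_ ?_ ?_ <;>
      simp [Rel, hψ]

theorem edist_le_three_of_intersect {i : Fin m} (hx : x i = true) (hy : y i = true)
    (hψ : ∀ k, π (ψ k) = k) (v w : Fin n) :
    (kindGraph (Rel x y) Rel.symm π).edist v w ≤ 3 := by
  have hsame : ∀ v w, (π v).1 = (π w).1 → (kindGraph (Rel x y) Rel.symm π).edist v w ≤ 3 := by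
    intro v w h
    refine (kindGraph_edist_le_two hψ ((π v).1, hub) ?_ ?_).trans (by norm_num)
    · simp [Rel]
    · simp [Rel, h]
  have hcross : ∀ v w, (π v).1 = false → (π w).1 = true →
      (kindGraph (Rel x y) Rel.symm π).edist v w ≤ 3 := by
    intro v w hv hw
    rcases hv' : π v with ⟨b, k⟩
    rcases hw' : π w with ⟨c, l⟩
    rw [hv'] at hv
    rw [hw'] at hw
    simp only at hv hw
    subst hv hw
    rcases k with _ | _ | j
    · rcases l with _ | _ | j
      · refine kindGraph_edist_le_three hψ (false, core i) (true, core i) ?_ ?_ ?_ <;>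
          simp [Rel, bit, hv', hw', hx, hy]
      · refine kindGraph_edist_le_three hψ (false, core i) (true, core i) ?_ ?_ ?_ <;>
          simp [Rel, bit, hv', hw', hx, hy]
      · refine kindGraph_edist_le_three hψ (false, hub) (false, core j) ?_ ?_ ?_ <;>
          simp [Rel, bit, hv', hw']
    · rcases l with _ | _ | j
      · refine kindGraph_edist_le_three hψ (false, core i) (true, core i) ?_ ?_ ?_ <;>
          simp [Rel, bit, hv', hw', hx, hy]
      · refine kindGraph_edist_le_three hψ (false, core i) (true, core i) ?_ ?_ ?_ <;>
          simp [Rel, bit, hv', hw', hx, hy]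
      · refine kindGraph_edist_le_three hψ (false, hub) (false, core j) ?_ ?_ ?_ <;>
          simp [Rel, bit, hv', hw']
    · refine kindGraph_edist_le_three hψ (true, core j) (true, hub) ?_ ?_ ?_ <;>
        simp [Rel, bit, hv', hw']
  rcases hv : (π v).1 <;> rcases hw : (π w).1
  · exact hsame v w (by rw [hv, hw])
  · exact hcross v w hv hw
  · rw [SimpleGraph.edist_comm]
    exact hcross w v hw hv
  · exact hsame v w (by rw [hv, hw])

end SideKind

/-- Diameter is hard on claw-free graphs: the two tips are at distance `3` through an index in the
intersection, and at distance at least `4` if there is none. -/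
theorem exists_reduction_of_hasClaw {W : Type*} {H : SimpleGraph W} (hH : HasClaw H)
    {n m : ℕ} (hm : 0 < m) (hn : 2 * m + 4 ≤ n) : Nonempty (DisjointnessReduction H n m) := by
  obtain ⟨ψ, hinj⟩ : ∃ ψ : Bool × SideKind m → Fin n, Function.Injective ψ :=
    ⟨fun k => ⟨SideKind.code k, (SideKind.code_lt k).trans_le hn⟩,
      fun k l h => SideKind.code_injective (Fin.mk.inj_iff.1 h)⟩
  obtain ⟨π, hψ, -⟩ := exists_kinds ψ hinj (false, .tip)
  refine ⟨{
    G := fun x y => kindGraph (SideKind.Rel x y) SideKind.Rel.symm π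
    B := {v | (π v).1 = true}
    adj_left := fun x y y' v hv w => by
      rw [kindGraph_adj, kindGraph_adj,
        SideKind.rel_congr_right x y y' (Bool.eq_false_iff.2 hv)]
    adj_right := fun x x' y v hv w => by
      rw [kindGraph_adj, kindGraph_adj, SideKind.rel_congr_left x x' y hv]
    connected := fun x y => connected_of_edist_center_le _ (SideKind.edist_hub_le ⟨0, hm⟩ hψ)
    free := fun x y ⟨e⟩ => ?_
    D := {d | ¬ d ≤ 3}
    mem_of_disjoint := fun x y hxy hD => ?_
    notMem_of_intersect := fun x y i hx hy hD => hD (SimpleGraph.ediam_le_of_edist_le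
      (SideKind.edist_le_three_of_intersect hx hy hψ)) }⟩
  · obtain ⟨c, a, b, d, h1, h2, h3, hab, had, hbd, h4, h5, h6⟩ := hH.of_embedding e
    rcases SideKind.rel_of_rel_claw h1.2 h2.2 h3.2 with h | h | h
    · exact h4 ⟨hab, h⟩
    · exact h5 ⟨had, h⟩
    · exact h6 ⟨hbd, h⟩
  · have h4 := kindGraph_le_add_ediam (hR := SideKind.Rel.symm) hψ (SideKind.potential x y)
      (SideKind.potential_le hxy) (true, .tip) (false, .tip)
    have h5 := h4.trans (add_le_add le_rfl hD)
    simp only [SideKind.potential] at h5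
    norm_num at h5

end ClawFree

/-! ### Graphs of diameter two and three -/

section Dense

/-- The graph contains four independent vertices, `4P₁`. -/
def HasFourIndependent {V : Type*} (G : SimpleGraph V) : Prop :=
  ∃ a b c d, a ≠ b ∧ a ≠ c ∧ a ≠ d ∧ b ≠ c ∧ b ≠ d ∧ c ≠ d ∧
    ¬ G.Adj a b ∧ ¬ G.Adj a c ∧ ¬ G.Adj a d ∧ ¬ G.Adj b c ∧ ¬ G.Adj b d ∧ ¬ G.Adj c d

/-- The graph contains two edges `a b` and `c d` that induce `2P₂`. -/
def HasTwoEdges {V : Type*} (G : SimpleGraph V) : Prop :=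
  ∃ a b c d, G.Adj a b ∧ G.Adj c d ∧ a ≠ c ∧ a ≠ d ∧ b ≠ c ∧ b ≠ d ∧
    ¬ G.Adj a c ∧ ¬ G.Adj a d ∧ ¬ G.Adj b c ∧ ¬ G.Adj b d

/-- The graph contains a path `a b c d` and a vertex `e` that induce `P₄ + P₁`. -/
def HasPathAndVertex {V : Type*} (G : SimpleGraph V) : Prop :=
  ∃ a b c d e, G.Adj a b ∧ G.Adj b c ∧ G.Adj c d ∧ a ≠ c ∧ a ≠ d ∧ b ≠ d ∧
    ¬ G.Adj a c ∧ ¬ G.Adj a d ∧ ¬ G.Adj b d ∧ e ≠ a ∧ e ≠ b ∧ e ≠ c ∧ e ≠ d ∧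
    ¬ G.Adj e a ∧ ¬ G.Adj e b ∧ ¬ G.Adj e c ∧ ¬ G.Adj e d

variable {V W : Type*} {G : SimpleGraph V} {H : SimpleGraph W}

theorem HasFourIndependent.of_embedding (e : H ↪g G) (h : HasFourIndependent H) :
    HasFourIndependent G := by
  obtain ⟨a, b, c, d, h⟩ := h
  exact ⟨e a, e b, e c, e d, by simpa only [e.map_adj_iff, ne_eq, e.injective.eq_iff] using h⟩

theorem HasTwoEdges.of_embedding (e : H ↪g G) (h : HasTwoEdges H) : HasTwoEdges G := by
  obtain ⟨a, b, c, d, h⟩ := h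
  exact ⟨e a, e b, e c, e d, by simpa only [e.map_adj_iff, ne_eq, e.injective.eq_iff] using h⟩

theorem HasPathAndVertex.of_embedding (φ : H ↪g G) (h : HasPathAndVertex H) :
    HasPathAndVertex G := by
  obtain ⟨a, b, c, d, e, h⟩ := h
  exact ⟨φ a, φ b, φ c, φ d, φ e,
    by simpa only [φ.map_adj_iff, ne_eq, φ.injective.eq_iff] using h⟩

/-- The kinds of vertices of the graphs of diameter two and three: `u i` and `v i` for each index,
and a clique of the `w i` and of two further vertices `left` and `right`. -/
inductive CliqueKind (m : ℕ) : Type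
  | left | right
  | u (i : Fin m) | v (i : Fin m) | w (i : Fin m)

namespace CliqueKind

variable {m : ℕ}

/-- The vertices `u i` and `v i` have the common neighbour `w i` if `x i` is `false`, and the common
neighbour `left` if `y i` is `false`. All other pairs are at distance at most two for all bit
vectors. The `u i` are independent or a clique, and so are the `v i`, as `clique` says. -/
def Rel (clique : Prop) (x y : Fin m → Bool) : CliqueKind m → CliqueKind m → Prop
  | u _, u _ => clique
  | v _, v _ => clique
  | u _, v _ => False
  | v _, u _ => False
  | u i, w j => ¬ (i = j ∧ x i = true)
  | w j, u i => ¬ (i = j ∧ x i = true)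
  | v i, w j => i = j
  | w j, v i => i = j
  | u _, left => True
  | left, u _ => True
  | u _, right => False
  | right, u _ => False
  | v i, left => y i = false
  | left, v i => y i = false
  | _, _ => True

variable {clique : Prop} {x y : Fin m → Bool}

theorem Rel.symm (k l : CliqueKind m) (h : Rel clique x y k l) : Rel clique x y l k := by
  cases k <;> cases l <;> exact h

/-- An enumeration of the kinds. -/
def code : CliqueKind m → ℕ
  | left => 0
  | right => 1
  | u i => 3 * i + 2
  | v i => 3 * i + 3
  | w i => 3 * i + 4

theorem code_injective : Function.Injective (code : CliqueKind m → ℕ) := by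
  intro k l h
  cases k <;> cases l <;> simp only [code] at h <;> first | rfl | omega | (congr 1; omega)

theorem code_lt (k : CliqueKind m) : code k < 3 * m + 2 := by
  cases k <;> simp only [code] <;> omega

/-- The kinds that arrive in the second part of the stream. -/
def IsRight : CliqueKind m → Prop
  | left | right | v _ => True
  | _ => False

theorem rel_congr_right (x y y' : Fin m → Bool) {k : CliqueKind m} (hk : ¬ IsRight k)
    (l : CliqueKind m) : Rel clique x y k l ↔ Rel clique x y' k l := by
  cases k <;> simp only [IsRight, not_true_eq_false] at hk <;> cases l <;> simp only [Rel]

theorem rel_congr_left (x x' y : Fin m → Bool) {k : CliqueKind m} (hk : IsRight k)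
    (l : CliqueKind m) : Rel clique x y k l ↔ Rel clique x' y k l := by
  cases k <;> simp only [IsRight] at hk <;> cases l <;> simp only [Rel]

/-- For an index `i` in the intersection, a lower bound for the distance from `u i`. -/
def potential (i : Fin m) : CliqueKind m → ℕ
  | u j => if j = i then 0 else 1
  | v j => if j = i then 3 else 2
  | w j => if j = i then 2 else 1
  | left => 1
  | right => 2

variable {n : ℕ} {π : Fin n → CliqueKind m} {ψ : CliqueKind m → Fin n}

theorem edist_left_le (hψ : ∀ k, π (ψ k) = k) (a : Fin n) :
    (kindGraph (Rel clique x y) Rel.symm π).edist a (ψ left) ≤ (2 : ℕ) := by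
  cases ha : π a with
  | v i => exact kindGraph_edist_le_two hψ right (by simp [ha, Rel]) (by simp [hψ, Rel])
  | _ => exact kindGraph_edist_le_two hψ left (by simp [ha, Rel]) (by simp [hψ, Rel])

theorem edist_le_two_of_disjoint (hxy : ∀ i, ¬ (x i = true ∧ y i = true))
    (hψ : ∀ k, π (ψ k) = k) (a b : Fin n) :
    (kindGraph (Rel clique x y) Rel.symm π).edist a b ≤ 2 := by
  have key : ∃ k, Rel clique x y (π a) k ∧ Rel clique x y k (π b) := by
    have huv : ∀ i j, ∃ k, Rel clique x y (u i) k ∧ Rel clique x y k (v j) := by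
      intro i j
      by_cases hij : i = j ∧ x i = true
      · obtain ⟨rfl, hi⟩ := hij
        refine ⟨left, trivial, ?_⟩
        have := hxy i
        simp only [hi, true_and, Bool.not_eq_true] at this
        exact this
      · exact ⟨w j, hij, rfl⟩
    cases π a <;> cases π b <;>
      first
      | exact huv _ _
      | exact (huv _ _).imp fun k h => ⟨h.2.symm, h.1.symm⟩
      | exact ⟨left, trivial, trivial⟩
      | exact ⟨right, trivial, trivial⟩
  obtain ⟨k, h, h'⟩ := key
  exact kindGraph_edist_le_two hψ k h h'

theorem potential_le {i : Fin m} (hx : x i = true) (hy : y i = true) (k l : CliqueKind m)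
    (h : Rel clique x y k l) : potential i k ≤ potential i l + 1 := by
  cases k <;> cases l <;> simp only [Rel] at h <;> simp only [potential] <;>
    (try split_ifs) <;> simp_all

/-- The three sets of vertices: the `u i`, the `v i`, and the clique of the others. -/
def color : CliqueKind m → Fin 3
  | u _ => 0
  | v _ => 1
  | _ => 2

theorem rel_of_color_eq_two {k l : CliqueKind m} (hk : color k = 2) (hl : color l = 2) :
    Rel clique x y k l := by
  cases k <;> simp [color] at hk <;> cases l <;> simp [color] at hl <;> trivial

theorem color_eq_two_of_rel (h : ¬ clique) {k l : CliqueKind m} (hkl : Rel clique x y k l) :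
    color k = 2 ∨ color l = 2 := by
  cases k <;> cases l <;> first | exact Or.inl rfl | exact Or.inr rfl | exact (h hkl).elim |
    exact hkl.elim

/-- The split graphs contain no `2P₂`: each edge has an end in the clique. -/
theorem not_hasTwoEdges (h : ¬ clique) : ¬ HasTwoEdges (kindGraph (Rel clique x y) Rel.symm π) := by
  rintro ⟨a, b, c, d, hab, hcd, nac, nad, nbc, nbd, hac, had, hbc, hbd⟩
  rcases color_eq_two_of_rel h hab.2 with h1 | h1 <;>
    rcases color_eq_two_of_rel h hcd.2 with h2 | h2
  · exact hac ⟨nac, rel_of_color_eq_two h1 h2⟩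
  · exact had ⟨nad, rel_of_color_eq_two h1 h2⟩
  · exact hbc ⟨nbc, rel_of_color_eq_two h1 h2⟩
  · exact hbd ⟨nbd, rel_of_color_eq_two h1 h2⟩

theorem rel_of_color_eq (h : clique) {k l : CliqueKind m} (hkl : color k = color l) :
    Rel clique x y k l := by
  cases k <;> cases l <;> simp_all [color, Rel]

theorem not_hasFourIndependent (h : clique) :
    ¬ HasFourIndependent (kindGraph (Rel clique x y) Rel.symm π) := by
  rintro ⟨a, b, c, d, nab, nac, nad, nbc, nbd, ncd, hab, hac, had, hbc, hbd, hcd⟩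
  have pig : ∀ p q r s : Fin 3, p = q ∨ p = r ∨ p = s ∨ q = r ∨ q = s ∨ r = s := by decide
  rcases pig (color (π a)) (color (π b)) (color (π c)) (color (π d)) with h1 | h1 | h1 | h1 | h1 | h1
  · exact hab ⟨nab, rel_of_color_eq h h1⟩
  · exact hac ⟨nac, rel_of_color_eq h h1⟩
  · exact had ⟨nad, rel_of_color_eq h h1⟩
  · exact hbc ⟨nbc, rel_of_color_eq h h1⟩
  · exact hbd ⟨nbd, rel_of_color_eq h h1⟩
  · exact hcd ⟨ncd, rel_of_color_eq h h1⟩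

/-- If the ends of a path on four vertices and a further vertex lie in the three different cliques,
then the path and the vertex do not induce `P₄ + P₁`. -/
theorem not_path_of_color {a b c d e : CliqueKind m} (hab : color a = color b)
    (hcd : color c = color d) (hea : color e ≠ color a) (hec : color e ≠ color c)
    (hac : color a ≠ color c) (rbc : Rel clique x y b c) (nac : ¬ Rel clique x y a c)
    (nad : ¬ Rel clique x y a d) (nbd : ¬ Rel clique x y b d) (nea : ¬ Rel clique x y e a)
    (neb : ¬ Rel clique x y e b) (nec : ¬ Rel clique x y e c) (ned : ¬ Rel clique x y e d) :
    False := by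
  cases e <;> cases a <;> simp [color] at hea <;> cases b <;> simp [color] at hab <;> cases c <;>
    simp [color] at hec hac <;> cases d <;> simp [color] at hcd <;> simp_all [Rel]

theorem not_hasPathAndVertex (h : clique) :
    ¬ HasPathAndVertex (kindGraph (Rel clique x y) Rel.symm π) := by
  rintro ⟨a, b, c, d, e, rab, rbc, rcd, dac, dad, dbd, nac, nad, nbd, dea, deb, dec, ded,
    nea, neb, nec, ned⟩
  have hne : ∀ {v w : Fin n}, v ≠ w → ¬ (kindGraph (Rel clique x y) Rel.symm π).Adj v w →
      color (π v) ≠ color (π w) := fun hvw hn hc => hn ⟨hvw, rel_of_color_eq h hc⟩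
  have hnr : ∀ {v w : Fin n}, v ≠ w → ¬ (kindGraph (Rel clique x y) Rel.symm π).Adj v w →
      ¬ Rel clique x y (π v) (π w) := fun hvw hn hr => hn ⟨hvw, hr⟩
  have pig : ∀ p q r s t : Fin 3, t ≠ p → t ≠ q → t ≠ r → t ≠ s → p ≠ r → p ≠ s → q ≠ s →
      p = q ∧ r = s := by decide
  obtain ⟨hab, hcd⟩ := pig _ _ _ _ _ (hne dea nea) (hne deb neb) (hne dec nec) (hne ded ned)
    (hne dac nac) (hne dad nad) (hne dbd nbd)
  exact not_path_of_color hab hcd (hne dea nea) (hne dec nec) (hne dac nac) rbc.2 (hnr dac nac)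
    (hnr dad nad) (hnr dbd nbd) (hnr dea nea) (hnr deb neb) (hnr dec nec) (hnr ded ned)

end CliqueKind

/-- Telling diameter at most two from larger diameter is hard on graphs covered by a clique and two
further sets that are both independent or both cliques. -/
theorem exists_reduction_of_free (clique : Prop) {n m : ℕ} (hn : 3 * m + 2 ≤ n)
    (hfree : ∀ x y (π : Fin n → CliqueKind m),
      ¬ H.IsIndContained (kindGraph (CliqueKind.Rel clique x y) CliqueKind.Rel.symm π)) :
    Nonempty (DisjointnessReduction H n m) := by
  obtain ⟨ψ, hinj⟩ : ∃ ψ : CliqueKind m → Fin n, Function.Injective ψ :=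
    ⟨fun k => ⟨k.code, k.code_lt.trans_le hn⟩,
      fun k l h => CliqueKind.code_injective (Fin.mk.inj_iff.1 h)⟩
  obtain ⟨π, hψ, -⟩ := exists_kinds ψ hinj .right
  refine ⟨{
    G := fun x y => kindGraph (CliqueKind.Rel clique x y) CliqueKind.Rel.symm π
    B := {v | (π v).IsRight}
    adj_left := fun x y y' v hv w => by
      rw [kindGraph_adj, kindGraph_adj, CliqueKind.rel_congr_right x y y' hv]
    adj_right := fun x x' y v hv w => by
      rw [kindGraph_adj, kindGraph_adj, CliqueKind.rel_congr_left x x' y hv]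
    connected := fun x y => connected_of_edist_center_le _ (CliqueKind.edist_left_le hψ)
    free := fun x y => hfree x y π
    D := {d | d ≤ 2}
    mem_of_disjoint := fun x y hxy =>
      SimpleGraph.ediam_le_of_edist_le (CliqueKind.edist_le_two_of_disjoint hxy hψ)
    notMem_of_intersect := fun x y i hx hy hD => ?_ }⟩
  have h3 := kindGraph_le_add_ediam (hR := CliqueKind.Rel.symm (clique := clique)) hψ
    (CliqueKind.potential i) (CliqueKind.potential_le hx hy) (.v i) (.u i)
  have h4 := h3.trans (add_le_add le_rfl hD)
  simp only [CliqueKind.potential, if_true] at h4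
  norm_num at h4

end Dense

/-! ### Graphs that contain none of the hard patterns -/

section Classification

open SimpleGraph

theorem isIndContained_of_bijective {κ W V : Type*} {H : SimpleGraph W} {P : SimpleGraph V}
    (f : κ → W) (hf : Function.Bijective f) (g : κ → V) (hg : Function.Injective g)
    (h : ∀ i j, H.Adj (f i) (f j) ↔ P.Adj (g i) (g j)) : H.IsIndContained P := by
  let e := Equiv.ofBijective f hf
  refine ⟨⟨⟨fun w => g (e.symm w), hg.comp e.symm.injective⟩, ?_⟩⟩
  intro a b
  obtain ⟨i, rfl⟩ := e.surjective a
  obtain ⟨j, rfl⟩ := e.surjective b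
  change P.Adj (g (e.symm (e i))) (g (e.symm (e j))) ↔ H.Adj (f i) (f j)
  rw [e.symm_apply_apply, e.symm_apply_apply]
  exact (h i j).symm

theorem nonempty_iso_of_bijective {W V : Type*} {H : SimpleGraph W} {P : SimpleGraph V}
    (f : V → W) (hf : Function.Bijective f) (h : ∀ i j, H.Adj (f i) (f j) ↔ P.Adj i j) :
    Nonempty (H ≃g P) :=
  ⟨(⟨Equiv.ofBijective f hf, h _ _⟩ : P ≃g H).symm⟩

variable {W : Type*} {H : SimpleGraph W}

theorem SimpleGraph.IsAcyclic.not_triangle (hH : H.IsAcyclic) {a b c : W} (hab : H.Adj a b) (hbc : H.Adj b c) :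
    ¬ H.Adj a c := by
  intro hac
  refine hH (Walk.cons hab (Walk.cons hbc (Walk.cons hac.symm Walk.nil))) ?_
  have := hab.ne
  have := hbc.ne
  have := hac.ne
  simp_all [Walk.isCycle_def, Walk.isTrail_def, Ne.symm]

theorem SimpleGraph.IsAcyclic.not_square (hH : H.IsAcyclic) {a b c d : W} (hab : H.Adj a b) (hbc : H.Adj b c)
    (hcd : H.Adj c d) (hac : a ≠ c) (hbd : b ≠ d) : ¬ H.Adj a d := by
  intro had
  refine hH (Walk.cons hab (Walk.cons hbc (Walk.cons hcd (Walk.cons had.symm Walk.nil)))) ?_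
  have := hab.ne
  have := hbc.ne
  have := hcd.ne
  have := had.ne
  simp_all [Walk.isCycle_def, Walk.isTrail_def, Ne.symm]

theorem SimpleGraph.IsAcyclic.not_pentagon (hH : H.IsAcyclic) {a b c d e : W} (hab : H.Adj a b)
    (hbc : H.Adj b c) (hcd : H.Adj c d) (hde : H.Adj d e) (hac : a ≠ c) (had : a ≠ d)
    (hbd : b ≠ d) (hbe : b ≠ e) (hce : c ≠ e) : ¬ H.Adj a e := by
  intro hae
  refine hH (Walk.cons hab (Walk.cons hbc (Walk.cons hcd (Walk.cons hde
    (Walk.cons hae.symm Walk.nil))))) ?_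
  have := hab.ne
  have := hbc.ne
  have := hcd.ne
  have := hde.ne
  have := hae.ne
  simp_all [Walk.isCycle_def, Walk.isTrail_def, Ne.symm]

theorem not_adj_of_not_hasClaw (hH : H.IsAcyclic) (hclaw : ¬ HasClaw H) {c a b d : W}
    (ha : H.Adj c a) (hb : H.Adj c b) (hab : a ≠ b) (had : a ≠ d) (hbd : b ≠ d) :
    ¬ H.Adj c d := fun hd =>
  hclaw ⟨c, a, b, d, ha, hb, hd, hab, had, hbd, hH.not_triangle ha.symm hb,
    hH.not_triangle ha.symm hd, hH.not_triangle hb.symm hd⟩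

/-- A graph without edges and without four vertices is contained in `P₄` or is `3P₁`. -/
theorem isIndContained_or_iso_of_no_edge (hE : ∀ a b, ¬ H.Adj a b)
    (h4 : ¬ HasFourIndependent H) :
    H.IsIndContained (pathGraph 4) ∨
      Nonempty (H ≃g ((pathGraph 1).sum (pathGraph 1)).sum (pathGraph 1)) := by
  rcases isEmpty_or_nonempty W with hW | ⟨⟨a⟩⟩
  · exact Or.inl IsIndContained.of_isEmpty
  by_cases h1 : ∀ w, w = a
  · refine Or.inl (isIndContained_of_bijective (κ := Fin 1) ![a] ⟨?_, ?_⟩ ![0] ?_ ?_)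
    · exact Function.injective_of_subsingleton _
    · exact fun w => ⟨0, (h1 w).symm⟩
    · exact Function.injective_of_subsingleton _
    · simp
  push Not at h1
  obtain ⟨b, hb⟩ := h1
  by_cases h2 : ∀ w, w = a ∨ w = b
  · refine Or.inl (isIndContained_of_bijective (κ := Fin 2) ![a, b] ⟨?_, ?_⟩ ![0, 2] ?_ ?_)
    · simp [Function.Injective, Fin.forall_fin_succ, hb, hb.symm]
    · intro w
      rcases h2 w with rfl | rfl
      exacts [⟨0, rfl⟩, ⟨1, rfl⟩]
    · decide
    · simp [Fin.forall_fin_succ, hE, pathGraph_adj]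
  push Not at h2
  obtain ⟨c, hca, hcb⟩ := h2
  by_cases h3 : ∀ w, w = a ∨ w = b ∨ w = c
  · refine Or.inr (nonempty_iso_of_bijective
      (Sum.elim (Sum.elim (fun _ => a) fun _ => b) fun _ => c) ⟨?_, ?_⟩ ?_)
    · rintro ((i | i) | i) ((j | j) | j) h <;> simp_all [Ne.symm, Fin.eq_zero]
    · intro w
      rcases h3 w with rfl | rfl | rfl
      exacts [⟨.inl (.inl 0), rfl⟩, ⟨.inl (.inr 0), rfl⟩, ⟨.inr 0, rfl⟩]
    · rintro ((i | i) | i) ((j | j) | j) <;> simp [hE, SimpleGraph.sum, pathGraph_adj]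
  push Not at h3
  obtain ⟨d, hda, hdb, hdc⟩ := h3
  exact absurd ⟨a, b, c, d, hb.symm, hca.symm, hda.symm, hcb.symm, hdb.symm, hdc.symm,
    hE _ _, hE _ _, hE _ _, hE _ _, hE _ _, hE _ _⟩ h4

/-- An edge that meets no other edge: the graph is contained in `P₄` or is `P₂ + 2P₁`. -/
theorem isIndContained_or_iso_of_isolated_edge {u v : W} (huv : H.Adj u v)
    (hu : ∀ w, H.Adj u w → w = v) (hv : ∀ w, H.Adj v w → w = u)
    (h4 : ¬ HasFourIndependent H) (h22 : ¬ HasTwoEdges H) :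
    H.IsIndContained (pathGraph 4) ∨
      Nonempty (H ≃g (pathGraph 2).sum ((pathGraph 1).sum (pathGraph 1))) := by
  have hne := huv.ne
  have hu' : ∀ w, w ≠ v → ¬ H.Adj u w := fun w hw h => hw (hu w h)
  have hv' : ∀ w, w ≠ u → ¬ H.Adj v w := fun w hw h => hw (hv w h)
  have hE : ∀ a b, a ≠ u → a ≠ v → b ≠ u → b ≠ v → ¬ H.Adj a b := fun a b h1 h2 h3 h4 h =>
    h22 ⟨u, v, a, b, huv, h, h1.symm, h3.symm, h2.symm, h4.symm, hu' a h2, hu' b h4,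
      hv' a h1, hv' b h3⟩
  by_cases h1 : ∀ w, w = u ∨ w = v
  · refine Or.inl (isIndContained_of_bijective (κ := Fin 2) ![u, v] ⟨?_, ?_⟩ ![0, 1] ?_ ?_)
    · simp [Function.Injective, Fin.forall_fin_succ, hne, hne.symm]
    · intro w
      rcases h1 w with rfl | rfl
      exacts [⟨0, rfl⟩, ⟨1, rfl⟩]
    · decide
    · simp [Fin.forall_fin_succ, huv, huv.symm, pathGraph_adj]
  push Not at h1
  obtain ⟨a, hau, hav⟩ := h1
  have au := hu' a hav
  have av := hv' a hau
  by_cases h2 : ∀ w, w = u ∨ w = v ∨ w = a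
  · refine Or.inl (isIndContained_of_bijective (κ := Fin 3) ![u, v, a] ⟨?_, ?_⟩ ![0, 1, 3] ?_ ?_)
    · simp [Function.Injective, Fin.forall_fin_succ, hne, hne.symm, hau, hau.symm, hav, hav.symm]
    · intro w
      rcases h2 w with rfl | rfl | rfl
      exacts [⟨0, rfl⟩, ⟨1, rfl⟩, ⟨2, rfl⟩]
    · decide
    · simp [Fin.forall_fin_succ, huv, huv.symm, au, av, H.adj_comm a, pathGraph_adj]
  push Not at h2
  obtain ⟨b, hbu, hbv, hba⟩ := h2
  have bu := hu' b hbv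
  have bv := hv' b hbu
  have ab := hE a b hau hav hbu hbv
  by_cases h3 : ∀ w, w = u ∨ w = v ∨ w = a ∨ w = b
  · refine Or.inr (nonempty_iso_of_bijective
      (Sum.elim ![u, v] (Sum.elim (fun _ => a) fun _ => b)) ⟨?_, ?_⟩ ?_)
    · rintro (i | i | i) (j | j | j) <;> fin_cases i <;> fin_cases j <;>
        simp [hne, hne.symm, hau, hau.symm, hav, hav.symm, hbu, hbu.symm, hbv, hbv.symm, hba,
          hba.symm]
    · intro w
      rcases h3 w with rfl | rfl | rfl | rfl
      exacts [⟨.inl 0, rfl⟩, ⟨.inl 1, rfl⟩, ⟨.inr (.inl 0), rfl⟩, ⟨.inr (.inr 0), rfl⟩]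
    · rintro (i | i | i) (j | j | j) <;> fin_cases i <;> fin_cases j <;>
        simp [SimpleGraph.sum, pathGraph_adj, huv, huv.symm, au, av, bu, bv, ab, H.adj_comm a,
          H.adj_comm b]
  push Not at h3
  obtain ⟨c, hcu, hcv, hca, hcb⟩ := h3
  exact absurd ⟨u, a, b, c, hau.symm, hbu.symm, hcu.symm, hba.symm, hca.symm, hcb.symm,
    au, bu, hu' c hcv, ab, hE a c hau hav hcu hcv, hE b c hbu hbv hcu hcv⟩ h4

/-- A path `a b c` that meets no other edge: the graph is contained in `P₄` or is `P₃ + P₁`. -/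
theorem isIndContained_or_iso_of_isolated_path {a b c : W} (hab : H.Adj a b) (hbc : H.Adj b c)
    (hac : a ≠ c) (nac : ¬ H.Adj a c) (ha : ∀ w, H.Adj a w → w = b)
    (hb : ∀ w, H.Adj b w → w = a ∨ w = c) (hc : ∀ w, H.Adj c w → w = b)
    (h4 : ¬ HasFourIndependent H) (h22 : ¬ HasTwoEdges H) :
    H.IsIndContained (pathGraph 4) ∨
      Nonempty (H ≃g (pathGraph 3).sum (pathGraph 1)) := by
  have nab := hab.ne
  have nbc := hbc.ne
  have nac' : ¬ H.Adj c a := fun h => nac h.symm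
  by_cases h1 : ∀ w, w = a ∨ w = b ∨ w = c
  · refine Or.inl (isIndContained_of_bijective (κ := Fin 3) ![a, b, c] ⟨?_, ?_⟩ ![0, 1, 2] ?_ ?_)
    · simp [Function.Injective, Fin.forall_fin_succ, nab, nab.symm, nbc, nbc.symm, hac, hac.symm]
    · intro w
      rcases h1 w with rfl | rfl | rfl
      exacts [⟨0, rfl⟩, ⟨1, rfl⟩, ⟨2, rfl⟩]
    · decide
    · simp [Fin.forall_fin_succ, hab, hab.symm, hbc, hbc.symm, nac, nac', pathGraph_adj]
  push Not at h1
  obtain ⟨d, hda, hdb, hdc⟩ := h1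
  have ha' : ∀ w, w ≠ b → ¬ H.Adj a w := fun w h h' => h (ha w h')
  have hb' : ∀ w, w ≠ a → w ≠ c → ¬ H.Adj b w := fun w h h' h'' => (hb w h'').elim h h'
  have hc' : ∀ w, w ≠ b → ¬ H.Adj c w := fun w h h' => h (hc w h')
  have ad := ha' d hdb
  have bd := hb' d hda hdc
  have cd := hc' d hdb
  by_cases h2 : ∀ w, w = a ∨ w = b ∨ w = c ∨ w = d
  · refine Or.inr (nonempty_iso_of_bijective (Sum.elim ![a, b, c] fun _ => d) ⟨?_, ?_⟩ ?_)
    · rintro (i | i) (j | j) <;> fin_cases i <;> fin_cases j <;>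
        simp [nab, nab.symm, nbc, nbc.symm, hac, hac.symm, hda, hda.symm, hdb, hdb.symm, hdc,
          hdc.symm]
    · intro w
      rcases h2 w with rfl | rfl | rfl | rfl
      exacts [⟨.inl 0, rfl⟩, ⟨.inl 1, rfl⟩, ⟨.inl 2, rfl⟩, ⟨.inr 0, rfl⟩]
    · rintro (i | i) (j | j) <;> fin_cases i <;> fin_cases j <;>
        simp [SimpleGraph.sum, pathGraph_adj, hab, hab.symm, hbc, hbc.symm, nac, nac', ad, bd, cd,
          H.adj_comm d]
  push Not at h2
  obtain ⟨e, hea, heb, hec, hed⟩ := h2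
  have de : ¬ H.Adj d e := fun h => h22 ⟨a, b, d, e, hab, h, hda.symm, hea.symm, hdb.symm,
    heb.symm, ad, ha' e heb, bd, hb' e hea hec⟩
  exact absurd ⟨a, c, d, e, hac, hda.symm, hea.symm, hdc.symm, hec.symm, hed.symm, nac, ad,
    ha' e heb, cd, hc' e heb, de⟩ h4

/-- A path on four vertices in a graph without the hard patterns is the whole graph. -/
theorem isIndContained_of_path (hH : H.IsAcyclic) (hclaw : ¬ HasClaw H)
    (h22 : ¬ HasTwoEdges H) (h41 : ¬ HasPathAndVertex H) {a b c d : W} (hab : H.Adj a b)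
    (hbc : H.Adj b c) (hcd : H.Adj c d) (hac : a ≠ c) (hbd : b ≠ d) :
    H.IsIndContained (pathGraph 4) := by
  have nac := hH.not_triangle hab hbc
  have nbd := hH.not_triangle hbc hcd
  have had : a ≠ d := fun h => nbd (h ▸ hab.symm)
  have nad := hH.not_square hab hbc hcd hac hbd
  have hab' := hab.ne
  have hbc' := hbc.ne
  have hcd' := hcd.ne
  have hall : ∀ w, w = a ∨ w = b ∨ w = c ∨ w = d := by
    by_contra! hcon
    obtain ⟨w, hwa, hwb, hwc, hwd⟩ := hcon
    have nbw : ¬ H.Adj b w := not_adj_of_not_hasClaw hH hclaw hab.symm hbc hac hwa.symm hwc.symm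
    have ncw : ¬ H.Adj c w := not_adj_of_not_hasClaw hH hclaw hbc.symm hcd hbd hwb.symm hwd.symm
    have nboth : H.Adj a w → ¬ H.Adj w d := fun h h' =>
      hH.not_pentagon hab hbc hcd h'.symm hac had hbd hwb.symm hwc.symm h
    have naw : ¬ H.Adj a w := fun h => h22 ⟨a, w, c, d, h, hcd, hac, had, hwc, hwd, nac, nad,
      fun h' => ncw h'.symm, nboth h⟩
    have ndw : ¬ H.Adj d w := fun h => h22 ⟨d, w, a, b, h, hab, had.symm, hbd.symm, hwa, hwb,
      fun h' => nad h'.symm, fun h' => nbd h'.symm, fun h' => naw h'.symm, fun h' => nbw h'.symm⟩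
    exact h41 ⟨a, b, c, d, w, hab, hbc, hcd, hac, had, hbd, nac, nad, nbd, hwa, hwb, hwc, hwd,
      fun h => naw h.symm, fun h => nbw h.symm, fun h => ncw h.symm, fun h => ndw h.symm⟩
  refine isIndContained_of_bijective (κ := Fin 4) ![a, b, c, d] ⟨?_, ?_⟩ id Function.injective_id ?_
  · simp [Function.Injective, Fin.forall_fin_succ, hab', hab'.symm, hbc', hbc'.symm, hcd',
      hcd'.symm, hac, hac.symm, hbd, hbd.symm, had, had.symm]
  · intro w
    rcases hall w with rfl | rfl | rfl | rfl
    exacts [⟨0, rfl⟩, ⟨1, rfl⟩, ⟨2, rfl⟩, ⟨3, rfl⟩]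
  · simp [Fin.forall_fin_succ, pathGraph_adj, hab, hbc, hcd, nac, nbd, nad, hab.symm, hbc.symm,
      hcd.symm, H.adj_comm c a, H.adj_comm d a, H.adj_comm d b]

/-- Every graph other than the exceptions contains a cycle, a claw, `4P₁`, `2P₂` or `P₄ + P₁`. -/
theorem contains_hard_pattern
    (hP4 : ¬ H.IsIndContained (pathGraph 4))
    (h3P1 : ¬ Nonempty (H ≃g ((pathGraph 1).sum (pathGraph 1)).sum (pathGraph 1)))
    (hP3P1 : ¬ Nonempty (H ≃g (pathGraph 3).sum (pathGraph 1)))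
    (hP22P1 : ¬ Nonempty (H ≃g (pathGraph 2).sum ((pathGraph 1).sum (pathGraph 1)))) :
    ¬ H.IsAcyclic ∨ HasClaw H ∨ HasFourIndependent H ∨ HasTwoEdges H ∨ HasPathAndVertex H := by
  by_contra! ⟨hH, hclaw, h4, h22, h41⟩
  by_cases hE : ∀ a b, ¬ H.Adj a b
  · exact (isIndContained_or_iso_of_no_edge hE h4).elim hP4 h3P1
  by_cases hp : ∃ a b c, H.Adj a b ∧ H.Adj b c ∧ a ≠ c
  · obtain ⟨a, b, c, hab, hbc, hac⟩ := hp
    have nac := hH.not_triangle hab hbc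
    refine (isIndContained_or_iso_of_isolated_path hab hbc hac nac ?_ ?_ ?_ h4 h22).elim hP4 hP3P1
    · intro w haw
      by_contra hwb
      exact hP4 (isIndContained_of_path hH hclaw h22 h41 haw.symm hab hbc hwb hac)
    · intro w hbw
      by_contra! hw
      exact not_adj_of_not_hasClaw hH hclaw hab.symm hbc hac hw.1.symm hw.2.symm hbw
    · intro w hcw
      by_contra hwb
      exact hP4 (isIndContained_of_path hH hclaw h22 h41 hab hbc hcw hac (Ne.symm hwb))
  · push Not at hE hp
    obtain ⟨u, v, huv⟩ := hE
    exact (isIndContained_or_iso_of_isolated_edge huv (fun w hw => (hp v u w huv.symm hw).symm)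
      (fun w hw => (hp u v w huv hw).symm) h4 h22).elim hP4 hP22P1

end Classification

/-! ### The lower bound -/

theorem exists_reduction_of_hard_pattern {W : Type*} {H : SimpleGraph W}
    (h : ¬ H.IsAcyclic ∨ HasClaw H ∨ HasFourIndependent H ∨ HasTwoEdges H ∨ HasPathAndVertex H)
    {n m : ℕ} (hm : 0 < m) (hn : 3 * m + 6 ≤ n) : Nonempty (DisjointnessReduction H n m) := by
  rcases h with h | h | h | h | h
  · exact exists_reduction_of_not_isAcyclic h hn
  · exact exists_reduction_of_hasClaw h hm (by omega)
  · exact exists_reduction_of_free True (by omega) fun x y π ⟨e⟩ =>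
      CliqueKind.not_hasFourIndependent trivial (h.of_embedding e)
  · exact exists_reduction_of_free False (by omega) fun x y π ⟨e⟩ =>
      CliqueKind.not_hasTwoEdges not_false (h.of_embedding e)
  · exact exists_reduction_of_free True (by omega) fun x y π ⟨e⟩ =>
      CliqueKind.not_hasPathAndVertex trivial (h.of_embedding e)

theorem mainTheorem3 {W : Type*} [Finite W] (H : SimpleGraph W)
    (hP4 : ¬ H.IsIndContained (SimpleGraph.pathGraph 4))
    (h3P1 : ¬ Nonempty (H ≃g
      ((SimpleGraph.pathGraph 1).sum (SimpleGraph.pathGraph 1)).sum (SimpleGraph.pathGraph 1)))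
    (hP3P1 : ¬ Nonempty (H ≃g (SimpleGraph.pathGraph 3).sum (SimpleGraph.pathGraph 1)))
    (hP22P1 : ¬ Nonempty (H ≃g
      (SimpleGraph.pathGraph 2).sum ((SimpleGraph.pathGraph 1).sum (SimpleGraph.pathGraph 1)))) :
    ∃ c : ℝ, 0 < c ∧ ∃ N : ℕ, ∀ n : ℕ, N ≤ n → ∀ p : ℕ, 1 ≤ p →
      ∀ (s : ℕ) (𝒜 : PMF (ALAlgorithm n s)), SolvesDiameterOnConnectedFree H 𝒜 p →
        c * ((n : ℝ) / (p : ℝ)) ≤ (s : ℝ) := by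
  refine ⟨1 / 884736, by norm_num, 28, fun n hn p hp s 𝒜 h𝒜 => ?_⟩
  -- With `m = n / 4` indices all constructions fit into `n` vertices, and `n ≤ 8 * m`.
  obtain ⟨R⟩ := exists_reduction_of_hard_pattern (contains_hard_pattern hP4 h3P1 hP3P1 hP22P1)
    (n := n) (m := n / 4) (by omega) (by omega)
  have h1 := R.le_mul 𝒜 h𝒜
  have h2 : (n : ℝ) ≤ 8 * ((n / 4 : ℕ) : ℝ) := by exact_mod_cast (by omega : n ≤ 8 * (n / 4))
  have hp' : (0 : ℝ) < p := by exact_mod_cast hp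
  rw [← mul_div_assoc, div_le_iff₀ hp']
  linarith
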